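/- Let $\mathcal X=\{0,1\}$. A binary-input symmetric classical-quantum (BSCQ) channel $W$ is a map $x\mapsto\rho^x$ from $\{0,1\}$ to density matrices on $\mathbb C^d$ such that $\rho^1=U\rho^0U^\dagger$ for some unitary $U$ with $U^2=\mathbb I$. For a linear code $\mathcal C\subseteq\mathbb F_2^N$, let $\boldsymbol X$ be uniformly distributed on $\mathcal C$, let every bit be transmitted through an independent use of $W$, and let $$\rho_{X_0Y_{\sim 0}}=\frac1{|\mathcal C|}\sum_{\boldsymbol x\in\mathcal C}|x_0\rangle\langle x_0|\otimes\rho^{x_1}\otimes\cdots\otimes\rho^{x_{N-1}}$$ be the joint state of bit $0$ and of the outputs of the other bits. The extrinsic MMSE of $\mathcal C$ for decoding bit $0$ is $$\mathcal M(\mathcal C)=\min_{M=M^\dagger}\operatorname{Tr}\Bigl(\rho_{X_0Y_{\sim0}}\bigl((|0\rangle\langle0|-|1\rangle\langle1|)\otimes\mathbb I-\mathbb I\otimes M\bigr)^2\Bigr),$$ where $M$ ranges over all Hermitian operators on $Y_{\sim 0}$. The Reed–Muller code $\mathrm{RM}(r,m)\subseteq\mathbb F_2^{2^m}$ consists of the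 vectors of values, at the points of $\{0,1\}^m$ listed by binary expansion of the index $\ell\in\{0,\dots,2^m-1\}$ (least significant bit first), of the polynomials over $\mathbb F_2$ in $m$ variables of total degree at most $r$. For a set $I$ of coordinates, $\mathcal C|_I=\{\boldsymbol c_I:\boldsymbol c\in\mathcal C\}$, with the coordinates in $I$ listed in increasing order. **Lemma.** Let $r\ge0$, $m\ge2$, $N=2^m$, $\mathcal C=\mathrm{RM}(r,m)$, and let $A,B,C\subseteq\{1,\dots,N-1\}$ be pairwise disjoint sets such that the projections $\mathcal C'=\mathcal C|_{\{0\}\cup A\cup B}$ and $\mathcal C''=\mathcal C|_{\{0\}\cup A\cup C}$ are both equal to $\mathrm{RM}(r,m-1)$. Put $\kappa=|A|/(|A|+|B|)$. Then, for every BSCQ channel $W$, the extrinsic MMSEs for decoding bit $0$ satisfy $$\mathcal M(\mathcal C)\le\frac{1+\kappa}{2}\,\mathcal M(\mathcal C')+\frac{1-\kappa}{2}\,\mathcal M(\mathcal C')^2 .$$ -/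

import Mathlib

open scoped Kronecker ComplexOrder

noncomputable section

/-- The binary expansion of `ℓ < 2 ^ m`, as a point of `𝔽₂ᵐ` (coordinate `0` is the least
significant bit). -/
def binaryPoint (m : ℕ) (ℓ : Fin (2 ^ m)) : Fin m → ZMod 2 :=
  fun i => if (ℓ : ℕ).testBit i then 1 else 0

/-- Evaluation of an `m`-variate polynomial over `𝔽₂` at all `2 ^ m` points of `𝔽₂ᵐ`. -/
def evalAllPoints (m : ℕ) :
    MvPolynomial (Fin m) (ZMod 2) →ₗ[ZMod 2] (Fin (2 ^ m) → ZMod 2) :=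
  LinearMap.pi fun ℓ => (MvPolynomial.aeval (binaryPoint m ℓ)).toLinearMap

/-- The Reed-Muller code `RM(r, m)`: evaluation vectors of the polynomials of total degree at most
`r`. (As `b ^ 2 = b` for bits, multilinear polynomials of degree at most `r` give the same code.) -/
def reedMuller (r m : ℕ) : Submodule (ZMod 2) (Fin (2 ^ m) → ZMod 2) :=
  (MvPolynomial.restrictTotalDegree (Fin m) (ZMod 2) r).map (evalAllPoints m)

/-- The projection `𝒞|_I` of a code onto the coordinates in `I`, listed in increasing order. -/
def codeProjection {N k : ℕ} (𝒞 : Submodule (ZMod 2) (Fin N → ZMod 2)) (I : Finset (Fin N))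
    (hI : I.card = k) : Submodule (ZMod 2) (Fin k → ZMod 2) :=
  𝒞.map (LinearMap.funLeft (ZMod 2) (ZMod 2) (I.orderEmbOfFin hI))

/-- A binary-input symmetric classical-quantum channel with output space `ℂᵈ`: a pair of density
matrices exchanged by a unitary involution. -/
structure BSCQChannel (d : ℕ) where
  state : ZMod 2 → Matrix (Fin d) (Fin d) ℂ
  posSemidef : ∀ x, (state x).PosSemidef
  trace_eq_one : ∀ x, (state x).trace = 1
  symmetric : ∃ U ∈ Matrix.unitaryGroup (Fin d) ℂ,
    U * U = 1 ∧ state 1 = U * state 0 * U.conjTranspose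

/-- The tensor product of one `d × d` matrix for each site in `ι`, on `(ℂᵈ)^{⊗ι}`, in the product
basis (which is indexed by `ι → Fin d`). -/
def tensorMatrix {ι : Type*} [Fintype ι] {d : ℕ} (M : ι → Matrix (Fin d) (Fin d) ℂ) :
    Matrix (ι → Fin d) (ι → Fin d) ℂ :=
  Matrix.of fun a b => ∏ i, M i (a i) (b i)

/-- The observable `(|0⟩⟨0| - |1⟩⟨1|) ⊗ I` of the classical bit. -/
def bitObservable (η : Type*) [DecidableEq η] : Matrix (ZMod 2 × η) (ZMod 2 × η) ℂ :=
  (Matrix.single 0 0 1 - Matrix.single 1 1 1) ⊗ₖ (1 : Matrix η η ℂ)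

/-- The mean-squared error `Tr (ρ_{XY} (O_X - I ⊗ M)²)` of the observable `M` on `Y`. -/
def meanSquaredError {η : Type*} [Fintype η] [DecidableEq η]
    (ρ : Matrix (ZMod 2 × η) (ZMod 2 × η) ℂ) (M : Matrix η η ℂ) : ℝ :=
  (Matrix.trace (ρ * (bitObservable η - (1 : Matrix (ZMod 2) (ZMod 2) ℂ) ⊗ₖ M) ^ 2)).re

/-- The minimum mean-squared error over all observables (Hermitian matrices) on `Y`. -/
def minMeanSquaredError {η : Type*} [Fintype η] [DecidableEq η]
    (ρ : Matrix (ZMod 2 × η) (ZMod 2 × η) ℂ) : ℝ :=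
  ⨅ M : {M : Matrix η η ℂ // M.IsHermitian}, meanSquaredError ρ M.1

open Classical in
/-- The extrinsic classical-quantum state of bit `i₀`: for a uniformly random codeword `x` of `𝒞`
the classical register holds `x i₀`, and the quantum systems are the channel outputs of all the
other bits. -/
def extrinsicState {ι : Type*} [Fintype ι] {d : ℕ} (W : BSCQChannel d)
    (𝒞 : Submodule (ZMod 2) (ι → ZMod 2)) (i₀ : ι) :
    Matrix (ZMod 2 × ({i : ι // i ≠ i₀} → Fin d)) (ZMod 2 × ({i : ι // i ≠ i₀} → Fin d)) ℂ :=
  (Nat.card 𝒞 : ℂ)⁻¹ • ∑ x : ι → ZMod 2 with x ∈ 𝒞,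
    Matrix.single (x i₀) (x i₀) (1 : ℂ) ⊗ₖ
      tensorMatrix fun i : {i : ι // i ≠ i₀} => W.state (x i)

open Classical in
/-- The extrinsic MMSE `ℳ(𝒞)` for decoding bit `i₀` of the code `𝒞` used over the channel `W`. -/
def extrinsicMMSE {ι : Type*} [Fintype ι] {d : ℕ} (W : BSCQChannel d)
    (𝒞 : Submodule (ZMod 2) (ι → ZMod 2)) (i₀ : ι) : ℝ :=
  minMeanSquaredError (extrinsicState W 𝒞 i₀)

end

/-!
Let `1 - p` be the error of an observable `M` for the projected code `𝒟`. Placing `M` on the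
positions of the two projections gives two observables `X₁` and `X₂` for the full code, and the
theorem bounds the error of their average `(X₁ + X₂) / 2`.

*Reduction to the zero word.* The channel outputs for the two bits are exchanged by a Hermitian
involution, so the output for a codeword `c` is the output for the zero word conjugated by a
product of flips. The error of `M` is then the average over `c` of `‖1 - τ_c M‖²`, where `τ_c`
conjugates by the flips and multiplies by `(-1)^(c i₀)`, and where `⟨X, Y⟩ = Re Tr (ρ₀ Xᴴ Y)` is
the semi-inner product of the product state `ρ₀` of the zero word
(`meanSquaredError_extrinsicState`). By convexity `M` may be averaged over all `τ_c` and over the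
permutations of the positions that preserve the code and fix the decoded position; after
rescaling, `⟨1, M⟩ = ⟨M, M⟩ = p` (`exists_symmetric_observable`). The average `(X₁ + X₂) / 2` is
again fixed by every `τ_c`, hence its error is
`‖1 - (X₁ + X₂) / 2‖² = 1 - 3 p / 2 + ⟨X₁, X₂⟩ / 2`, and the theorem reduces to `⟨X₁, X₂⟩ ≤ p² + κ (p - p²)`.

*The correlation bound.* Since `ρ₀` is a product state, the partial expectations `E_S` over sets
`S` of positions are commuting self-adjoint projections. The observable `X₁` is fixed by the
expectation over the positions it does not touch, and likewise `X₂`, so `⟨X₁, X₂⟩` is unchanged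
when both are averaged over all positions that are not common. Since `2 ⟨X, Y⟩ ≤ ‖X‖² + ‖Y‖²`, it
remains to bound `‖E_T M‖²`, with `T` the complement of the common positions. The set function
`A ↦ ‖E_{Aᶜ} M‖²` is supermodular, because its increments are squared norms of vectors that shrink
under further projections; it is also invariant under the symmetries of the code. A supermodular
function is dominated by an additive one with the same total, and averaging the latter over a
transitive group makes it proportional to `|A|` (`card_mul_le_of_supermodular_of_transitive`).
This gives `‖E_T M‖² - p² ≤ κ (p - p²)` (`card_mul_stateForm_embedSites_le`).

*Reed-Muller codes.* Linear changes of coordinates preserve the total degree bound, and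
transvections carry any nonzero point to any other (`exists_mem_extrinsicSymmetry_reedMuller`), so
the symmetries fixing position `0` are transitive on the remaining positions. The infimum over `M`
passes to the limit because the bound is continuous and monotone in the error.
-/

noncomputable section

/-! ### Placing an operator on a subset of the sites -/

section Embed

variable {ι κ : Type*} {d : ℕ}

open Classical in
/-- The operator `X ⊗ 1` on the sites `ι`, with `X` acting on the sites `f j` and the identity on
the sites outside the range of `f`. For a permutation `f` this relabels the sites. -/
def embedSites (f : κ → ι) :
    Matrix (κ → Fin d) (κ → Fin d) ℂ →ₗ[ℂ] Matrix (ι → Fin d) (ι → Fin d) ℂ where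
  toFun X := Matrix.of fun a b =>
    if ∀ i, i ∉ Set.range f → a i = b i then X (a ∘ f) (b ∘ f) else 0
  map_add' X Y := by ext a b; simp only [Matrix.of_apply, Matrix.add_apply]; split_ifs <;> simp
  map_smul' c X := by ext a b; simp only [Matrix.of_apply, Matrix.smul_apply]; split_ifs <;> simp

theorem conjTranspose_embedSites {f : κ → ι} (X : Matrix (κ → Fin d) (κ → Fin d) ℂ) :
    (embedSites f X).conjTranspose = embedSites f X.conjTranspose := by
  ext a b
  simp only [embedSites, LinearMap.coe_mk, AddHom.coe_mk, Matrix.of_apply,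
    Matrix.conjTranspose_apply]
  by_cases h : ∀ i, i ∉ Set.range f → a i = b i
  · rw [if_pos h, if_pos fun i hi => (h i hi).symm]
  · rw [if_neg h, if_neg fun h' => h fun i hi => (h' i hi).symm]
    exact star_zero ℂ

end Embed

/-! ### Product matrices and product maps -/

section Tensor

variable {ι κ : Type*} [Fintype ι] [Fintype κ] {d : ℕ}

theorem tensorMatrix_one : tensorMatrix (fun _ : ι => (1 : Matrix (Fin d) (Fin d) ℂ)) = 1 := by
  ext a b
  simp only [tensorMatrix, Matrix.of_apply, Matrix.one_apply, Finset.prod_ite_zero]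
  simp [funext_iff]

theorem conjTranspose_tensorMatrix (M : ι → Matrix (Fin d) (Fin d) ℂ) :
    (tensorMatrix M).conjTranspose = tensorMatrix fun i => (M i).conjTranspose := by
  ext a b
  simp [tensorMatrix, Matrix.conjTranspose_apply]

theorem single_eq_tensorMatrix (a b : ι → Fin d) :
    Matrix.single a b (1 : ℂ) = tensorMatrix fun i => Matrix.single (a i) (b i) 1 := by
  ext s t
  simp only [tensorMatrix, Matrix.of_apply, Matrix.single_apply, Finset.prod_ite_zero]
  simp [funext_iff, forall_and]

/-- Product matrices span, so a property closed under sums need only be checked on their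
multiples. -/
theorem tensorMatrix_induction {P : Matrix (ι → Fin d) (ι → Fin d) ℂ → Prop}
    (hadd : ∀ X Y, P X → P Y → P (X + Y)) (hsmul : ∀ (c : ℂ) M, P (c • tensorMatrix M))
    (X : Matrix (ι → Fin d) (ι → Fin d) ℂ) : P X := by
  refine Matrix.induction_on' X ?_ hadd fun a b c => ?_
  · simpa using hsmul 0 fun _ => 1
  · have := hsmul c fun i => Matrix.single (a i) (b i) 1
    rwa [← single_eq_tensorMatrix, Matrix.smul_single, smul_eq_mul, mul_one] at this

variable [DecidableEq ι]

theorem tensorMatrix_mul (M N : ι → Matrix (Fin d) (Fin d) ℂ) :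
    tensorMatrix M * tensorMatrix N = tensorMatrix fun i => M i * N i := by
  ext a b
  simp only [tensorMatrix, Matrix.mul_apply, Matrix.of_apply, ← Finset.prod_mul_distrib]
  rw [Finset.prod_univ_sum, Fintype.piFinset_univ]

theorem trace_tensorMatrix (M : ι → Matrix (Fin d) (Fin d) ℂ) :
    (tensorMatrix M).trace = ∏ i, (M i).trace := by
  simp only [tensorMatrix, Matrix.trace, Matrix.diag_apply, Matrix.of_apply]
  rw [Finset.prod_univ_sum, Fintype.piFinset_univ]

open scoped MatrixOrder Matrix.Norms.L2Operator in
theorem posSemidef_tensorMatrix {M : ι → Matrix (Fin d) (Fin d) ℂ}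
    (hM : ∀ i, (M i).PosSemidef) : (tensorMatrix M).PosSemidef := by
  have h : ∀ i, ∃ B : Matrix (Fin d) (Fin d) ℂ, M i = B.conjTranspose * B := fun i => by
    exact CStarAlgebra.nonneg_iff_eq_star_mul_self.mp (hM i).nonneg
  choose B hB using h
  have : tensorMatrix M = (tensorMatrix B).conjTranspose * tensorMatrix B := by
    rw [conjTranspose_tensorMatrix, tensorMatrix_mul]
    exact congrArg _ (funext hB)
  rw [this]
  exact Matrix.posSemidef_conjTranspose_mul_self _

/-- The tensor product `⨂ L i` of linear maps on single-site matrices. -/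
def tensorMap (L : ι → Matrix (Fin d) (Fin d) ℂ →ₗ[ℂ] Matrix (Fin d) (Fin d) ℂ) :
    Matrix (ι → Fin d) (ι → Fin d) ℂ →ₗ[ℂ] Matrix (ι → Fin d) (ι → Fin d) ℂ where
  toFun X := ∑ s, ∑ t, X s t • tensorMatrix fun i => L i (Matrix.single (s i) (t i) 1)
  map_add' X Y := by simp only [Matrix.add_apply, add_smul, Finset.sum_add_distrib]
  map_smul' c X := by
    simp only [Matrix.smul_apply, smul_eq_mul, mul_smul, Finset.smul_sum, RingHom.id_apply]

theorem tensorMap_tensorMatrix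
    (L : ι → Matrix (Fin d) (Fin d) ℂ →ₗ[ℂ] Matrix (Fin d) (Fin d) ℂ)
    (M : ι → Matrix (Fin d) (Fin d) ℂ) :
    tensorMap L (tensorMatrix M) = tensorMatrix fun i => L i (M i) := by
  have key : ∀ i, L i (M i) = ∑ s, ∑ t, M i s t • L i (Matrix.single s t 1) := fun i => by
    conv_lhs => rw [Matrix.matrix_eq_sum_single (M i)]
    simp only [map_sum, ← map_smul, Matrix.smul_single, smul_eq_mul, mul_one]
  ext a b
  simp only [tensorMap, LinearMap.coe_mk, AddHom.coe_mk, Matrix.sum_apply, Matrix.smul_apply,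
    smul_eq_mul]
  simp only [tensorMatrix, Matrix.of_apply, key, Matrix.sum_apply, Matrix.smul_apply, smul_eq_mul]
  simp only [Finset.prod_univ_sum, Fintype.piFinset_univ, Finset.prod_mul_distrib]

theorem tensorMap_comp
    (L K : ι → Matrix (Fin d) (Fin d) ℂ →ₗ[ℂ] Matrix (Fin d) (Fin d) ℂ)
    (X : Matrix (ι → Fin d) (ι → Fin d) ℂ) :
    tensorMap L (tensorMap K X) = tensorMap (fun i => L i ∘ₗ K i) X := by
  induction X using tensorMatrix_induction with
  | hadd X Y hX hY => simp only [map_add, hX, hY]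
  | hsmul c M => simp only [map_smul, tensorMap_tensorMatrix, LinearMap.comp_apply]

theorem tensorMap_id (X : Matrix (ι → Fin d) (ι → Fin d) ℂ) :
    tensorMap (fun _ => LinearMap.id) X = X := by
  induction X using tensorMatrix_induction with
  | hadd X Y hX hY => simp only [map_add, hX, hY]
  | hsmul c M => simp only [map_smul, tensorMap_tensorMatrix, LinearMap.id_apply]

theorem tensorMap_one
    {L : ι → Matrix (Fin d) (Fin d) ℂ →ₗ[ℂ] Matrix (Fin d) (Fin d) ℂ}
    (hL : ∀ i, L i 1 = 1) : tensorMap L 1 = 1 := by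
  rw [← tensorMatrix_one, tensorMap_tensorMatrix]
  simp only [hL]

theorem conjTranspose_tensorMap
    {L : ι → Matrix (Fin d) (Fin d) ℂ →ₗ[ℂ] Matrix (Fin d) (Fin d) ℂ}
    (hL : ∀ i N, L i N.conjTranspose = (L i N).conjTranspose)
    (X : Matrix (ι → Fin d) (ι → Fin d) ℂ) :
    (tensorMap L X).conjTranspose = tensorMap L X.conjTranspose := by
  induction X using tensorMatrix_induction with
  | hadd X Y hX hY => simp only [map_add, hX, hY, Matrix.conjTranspose_add]
  | hsmul c M =>
    simp only [map_smul, tensorMap_tensorMatrix, Matrix.conjTranspose_smul,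
      conjTranspose_tensorMatrix, hL]

theorem tensorMap_mul
    {L : ι → Matrix (Fin d) (Fin d) ℂ →ₗ[ℂ] Matrix (Fin d) (Fin d) ℂ}
    (hL : ∀ i M N, L i (M * N) = L i M * L i N)
    (X Y : Matrix (ι → Fin d) (ι → Fin d) ℂ) :
    tensorMap L (X * Y) = tensorMap L X * tensorMap L Y := by
  induction X using tensorMatrix_induction with
  | hadd X X' hX hX' => simp only [add_mul, map_add, hX, hX']
  | hsmul c M =>
    induction Y using tensorMatrix_induction with
    | hadd Y Y' hY hY' => simp only [mul_add, map_add, hY, hY']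
    | hsmul c' N =>
      simp only [Matrix.smul_mul, Matrix.mul_smul, map_smul, tensorMap_tensorMatrix,
        tensorMatrix_mul, hL]

/-- A product map which is sitewise self-adjoint for the pairings `(M, N) ↦ Tr (R M N)` is
self-adjoint for the pairing given by the product matrix. -/
theorem trace_tensorMatrix_mul_tensorMap {R : ι → Matrix (Fin d) (Fin d) ℂ}
    {L K : ι → Matrix (Fin d) (Fin d) ℂ →ₗ[ℂ] Matrix (Fin d) (Fin d) ℂ}
    (hL : ∀ i M N, (R i * L i M * N).trace = (R i * M * K i N).trace)
    (X Y : Matrix (ι → Fin d) (ι → Fin d) ℂ) :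
    (tensorMatrix R * tensorMap L X * Y).trace = (tensorMatrix R * X * tensorMap K Y).trace := by
  induction X using tensorMatrix_induction with
  | hadd X X' hX hX' => simp only [add_mul, mul_add, map_add, Matrix.trace_add, hX, hX']
  | hsmul c M =>
    induction Y using tensorMatrix_induction with
    | hadd Y Y' hY hY' => simp only [mul_add, map_add, Matrix.trace_add, hY, hY']
    | hsmul c' N =>
      simp only [Matrix.smul_mul, Matrix.mul_smul, map_smul, tensorMap_tensorMatrix,
        tensorMatrix_mul, Matrix.trace_smul, trace_tensorMatrix, hL]

/-- The trace against a product matrix transforms under a product map by its sitewise dual. -/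
theorem trace_tensorMatrix_mul_tensorMap_of_trace
    {R R' : ι → Matrix (Fin d) (Fin d) ℂ}
    {L : ι → Matrix (Fin d) (Fin d) ℂ →ₗ[ℂ] Matrix (Fin d) (Fin d) ℂ}
    (hL : ∀ i M, (R i * L i M).trace = (R' i * M).trace)
    (X : Matrix (ι → Fin d) (ι → Fin d) ℂ) :
    (tensorMatrix R * tensorMap L X).trace = (tensorMatrix R' * X).trace := by
  induction X using tensorMatrix_induction with
  | hadd X X' hX hX' => simp only [mul_add, map_add, Matrix.trace_add, hX, hX']
  | hsmul c M =>
    simp only [Matrix.mul_smul, map_smul, tensorMap_tensorMatrix,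
        tensorMatrix_mul, Matrix.trace_smul, trace_tensorMatrix, hL]

theorem embedSites_tensorMatrix {f : κ → ι} (hf : f.Injective)
    (M : κ → Matrix (Fin d) (Fin d) ℂ) :
    embedSites f (tensorMatrix M) = tensorMatrix (Function.extend f M fun _ => 1) := by
  classical
  ext a b
  simp only [embedSites, LinearMap.coe_mk, AddHom.coe_mk, tensorMatrix, Matrix.of_apply]
  have hsplit : ∏ i, Function.extend f M (fun _ => 1) i (a i) (b i) =
      (∏ j, M j (a (f j)) (b (f j))) * ∏ i with i ∉ Set.range f, if a i = b i then 1 else 0 := by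
    rw [← Finset.prod_filter_mul_prod_filter_not Finset.univ (· ∈ Set.range f)]
    congr 1
    · rw [show Finset.univ.filter (· ∈ Set.range f) = Finset.univ.image f by ext; simp,
        Finset.prod_image fun x _ y _ h => hf h]
      simp only [hf.extend_apply]
    · refine Finset.prod_congr rfl fun i hi => ?_
      rw [Function.extend_apply' _ _ _ (by simpa using hi), Matrix.one_apply]
  rw [hsplit, Finset.prod_ite_zero]
  simp

variable {f : κ → ι}

theorem embedSites_one (hf : f.Injective) :
    embedSites (d := d) f 1 = 1 := by
  rw [← tensorMatrix_one, embedSites_tensorMatrix hf, ← tensorMatrix_one]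
  congr 1
  funext i
  by_cases h : ∃ j, f j = i
  · obtain ⟨j, rfl⟩ := h
    exact hf.extend_apply _ _ _
  · exact Function.extend_apply' _ _ _ h

variable [DecidableEq κ]

theorem tensorMap_embedSites (hf : f.Injective)
    {L : ι → Matrix (Fin d) (Fin d) ℂ →ₗ[ℂ] Matrix (Fin d) (Fin d) ℂ}
    (hL : ∀ i, L i 1 = 1) (X : Matrix (κ → Fin d) (κ → Fin d) ℂ) :
    tensorMap L (embedSites f X) = embedSites f (tensorMap (fun j => L (f j)) X) := by
  induction X using tensorMatrix_induction with
  | hadd X Y hX hY => simp only [map_add, hX, hY]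
  | hsmul c M =>
    simp only [map_smul, embedSites_tensorMatrix hf, tensorMap_tensorMatrix]
    congr 2
    funext i
    by_cases h : ∃ j, f j = i
    · obtain ⟨j, rfl⟩ := h
      simp only [hf.extend_apply]
    · simp only [Function.extend_apply' _ _ _ h, hL]

theorem embedSites_mul (hf : f.Injective) (X Y : Matrix (κ → Fin d) (κ → Fin d) ℂ) :
    embedSites f (X * Y) = embedSites f X * embedSites f Y := by
  induction X using tensorMatrix_induction with
  | hadd X X' hX hX' => simp only [add_mul, map_add, hX, hX']
  | hsmul c M =>
    induction Y using tensorMatrix_induction with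
    | hadd Y Y' hY hY' => simp only [mul_add, map_add, hY, hY']
    | hsmul c' N =>
      simp only [Matrix.smul_mul, Matrix.mul_smul, map_smul, embedSites_tensorMatrix hf,
        tensorMatrix_mul]
      congr 3
      funext i
      by_cases h : ∃ j, f j = i
      · obtain ⟨j, rfl⟩ := h
        simp only [hf.extend_apply]
      · simp only [Function.extend_apply' _ _ _ h, mul_one]

/-- Sites in unit-trace states on which an observable acts trivially can be traced out. -/
theorem trace_tensorMatrix_mul_embedSites (hf : f.Injective)
    {R : ι → Matrix (Fin d) (Fin d) ℂ} (hR : ∀ i, (R i).trace = 1)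
    (X : Matrix (κ → Fin d) (κ → Fin d) ℂ) :
    (tensorMatrix R * embedSites f X).trace = (tensorMatrix (fun j => R (f j)) * X).trace := by
  induction X using tensorMatrix_induction with
  | hadd X X' hX hX' => simp only [mul_add, map_add, Matrix.trace_add, hX, hX']
  | hsmul c M =>
    simp only [Matrix.mul_smul, map_smul, embedSites_tensorMatrix hf, tensorMatrix_mul,
      Matrix.trace_smul, trace_tensorMatrix]
    congr 1
    rw [← Finset.prod_filter_mul_prod_filter_not Finset.univ (· ∈ Set.range f)]
    rw [show Finset.univ.filter (· ∈ Set.range f) = Finset.univ.image f by ext; simp,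
        Finset.prod_image fun x _ y _ h => hf h]
    simp only [hf.extend_apply]
    rw [Finset.prod_eq_one (s := Finset.univ.filter fun i => ¬ i ∈ Set.range f), mul_one]
    intro i hi
    rw [Function.extend_apply' _ _ _ (by simpa using hi), mul_one, hR]

end Tensor

/-! ### Supermodular set functions and commuting projections -/

section Supermodular

variable {J : Type*} [DecidableEq J]

/-- The vector of marginal increments along any ordering of `U` dominates a supermodular set
function on the subsets of `U`, with equality on `U` itself. -/
theorem exists_sum_ge_of_supermodular {h : Finset J → ℝ}
    (hsup : ∀ A U i, A ⊆ U → i ∉ U → h (insert i A) - h A ≤ h (insert i U) - h U)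
    (U : Finset J) :
    ∃ Δ : J → ℝ, ∑ i ∈ U, Δ i = h U - h ∅ ∧ ∀ A ⊆ U, h A - h ∅ ≤ ∑ i ∈ A, Δ i := by
  induction U using Finset.induction_on with
  | empty =>
    refine ⟨0, by simp, fun A hA => ?_⟩
    rw [Finset.subset_empty.mp hA]
    simp
  | insert j U hj ih =>
    obtain ⟨Δ, hΔ, hle⟩ := ih
    have hcongr : ∀ A ⊆ U,
        ∑ i ∈ A, Function.update Δ j (h (insert j U) - h U) i = ∑ i ∈ A, Δ i := fun A hA =>
      Finset.sum_congr rfl fun i hi =>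
        Function.update_of_ne (ne_of_mem_of_not_mem (hA hi) hj) _ _
    refine ⟨Function.update Δ j (h (insert j U) - h U), ?_, fun A hA => ?_⟩
    · rw [Finset.sum_insert hj, Function.update_self, hcongr U subset_rfl, hΔ]
      ring
    · by_cases hjA : j ∈ A
      · have hsub : A.erase j ⊆ U := by
          rwa [← Finset.subset_insert_iff]
        have h1 := hsup (A.erase j) U j hsub hj
        have h2 := hle _ hsub
        rw [Finset.insert_erase hjA] at h1
        rw [← Finset.insert_erase hjA, Finset.sum_insert (Finset.notMem_erase j A),
          Function.update_self, hcongr _ hsub, Finset.insert_erase hjA]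
        linarith
      · have hsub : A ⊆ U := (Finset.subset_insert_iff_of_notMem hjA).mp hA
        rw [hcongr A hsub]
        exact hle A hsub

/-- A supermodular set function invariant under a transitive permutation group lies below its
linear interpolation in the cardinality. -/
theorem card_mul_le_of_supermodular_of_transitive [Fintype J] {h : Finset J → ℝ}
    (hsup : ∀ A U i, A ⊆ U → i ∉ U → h (insert i A) - h A ≤ h (insert i U) - h U)
    (G : Subgroup (Equiv.Perm J)) (htrans : ∀ i j, ∃ g ∈ G, g i = j)
    (hinv : ∀ g ∈ G, ∀ A : Finset J, h (A.map g.toEmbedding) = h A) (A : Finset J) :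
    (Fintype.card J : ℝ) * (h A - h ∅) ≤ A.card * (h Finset.univ - h ∅) := by
  classical
  obtain ⟨Δ, hΔ, hle⟩ := exists_sum_ge_of_supermodular hsup Finset.univ
  -- By transitivity, the average of `Δ` over the orbit of a point does not depend on the point.
  have horbit : ∀ i j, ∑ g : G, Δ (g.1 i) = ∑ g : G, Δ (g.1 j) := fun i j => by
    obtain ⟨k, hk, rfl⟩ := htrans i j
    exact (Equiv.sum_comp (Equiv.mulRight (⟨k, hk⟩ : G)) fun g : G => Δ (g.1 i)).symm
  have hconst : ∀ i, (Fintype.card J : ℝ) * ∑ g : G, Δ (g.1 i) =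
      Fintype.card G * (h Finset.univ - h ∅) := fun i => by
    calc (Fintype.card J : ℝ) * ∑ g : G, Δ (g.1 i) = ∑ j, ∑ g : G, Δ (g.1 j) := by
          rw [Finset.sum_congr rfl fun j _ => horbit j i, Finset.sum_const, Finset.card_univ,
            nsmul_eq_mul]
      _ = ∑ g : G, ∑ j, Δ (g.1 j) := Finset.sum_comm
      _ = _ := by
          simp only [Equiv.sum_comp, hΔ, Finset.sum_const, Finset.card_univ, nsmul_eq_mul]
  have hsum : (Fintype.card G : ℝ) * (h A - h ∅) ≤ ∑ i ∈ A, ∑ g : G, Δ (g.1 i) := by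
    rw [Finset.sum_comm, ← nsmul_eq_mul, ← Finset.card_univ, ← Finset.sum_const]
    refine Finset.sum_le_sum fun g _ => ?_
    have := hle (A.map g.1.toEmbedding) (Finset.subset_univ _)
    rwa [hinv g.1 g.2, Finset.sum_map] at this
  have hpos : (0 : ℝ) < Fintype.card G := by exact_mod_cast Fintype.card_pos
  refine le_of_mul_le_mul_left ?_ hpos
  calc (Fintype.card G : ℝ) * (Fintype.card J * (h A - h ∅))
      = Fintype.card J * (Fintype.card G * (h A - h ∅)) := by ring
    _ ≤ Fintype.card J * ∑ i ∈ A, ∑ g : G, Δ (g.1 i) := by gcongr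
    _ = ∑ i ∈ A, (Fintype.card G : ℝ) * (h Finset.univ - h ∅) := by
        rw [Finset.mul_sum]
        exact Finset.sum_congr rfl fun i _ => hconst i
    _ = _ := by rw [Finset.sum_const, nsmul_eq_mul]; ring

end Supermodular

section Form

variable {V : Type*} [AddCommGroup V] [Module ℝ V] {b : LinearMap.BilinForm ℝ V}

theorem two_mul_apply_le_of_isPosSemidef (hb : b.IsPosSemidef) (x y : V) :
    2 * b x y ≤ b x x + b y y := by
  have h := hb.nonneg (x - y)
  simp only [map_sub, LinearMap.sub_apply] at h
  rw [hb.eq y x] at h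
  linarith

/-- The quadratic form of a positive semidefinite form is convex. -/
theorem apply_average_le_of_isPosSemidef (hb : b.IsPosSemidef) {ι : Type*} (s : Finset ι)
    (hs : s.Nonempty) (y : ι → V) :
    b ((s.card : ℝ)⁻¹ • ∑ i ∈ s, y i) ((s.card : ℝ)⁻¹ • ∑ i ∈ s, y i) ≤
      (s.card : ℝ)⁻¹ * ∑ i ∈ s, b (y i) (y i) := by
  have hpos : (0 : ℝ) < s.card := by exact_mod_cast hs.card_pos
  have hsum : b (∑ i ∈ s, y i) (∑ i ∈ s, y i) ≤ s.card * ∑ i ∈ s, b (y i) (y i) := by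
    have h : ∑ i ∈ s, ∑ j ∈ s, 2 * b (y i) (y j) ≤
        ∑ i ∈ s, ∑ j ∈ s, (b (y i) (y i) + b (y j) (y j)) :=
      Finset.sum_le_sum fun i _ => Finset.sum_le_sum fun j _ =>
        two_mul_apply_le_of_isPosSemidef hb _ _
    simp only [Finset.sum_add_distrib, Finset.sum_const, nsmul_eq_mul, ← Finset.mul_sum] at h
    simp only [map_sum, LinearMap.sum_apply]
    rw [Finset.sum_comm]
    linarith
  simp only [map_smul, LinearMap.smul_apply, smul_eq_mul]
  gcongr
  rw [inv_mul_le_iff₀ hpos]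
  exact hsum

variable {J : Type*} [DecidableEq J]

/-- For a family of commuting self-adjoint projections, `A ↦ ⟨P Aᶜ x, x⟩` is supermodular: the
increments are squared norms of vectors, which only shrink when more projections are applied. -/
theorem supermodular_of_projections [Fintype J] (hb : b.IsPosSemidef)
    {P : Finset J → V →ₗ[ℝ] V} (hP : ∀ S T x, P S (P T x) = P (S ∪ T) x)
    (hadj : ∀ S x y, b (P S x) y = b x (P S y)) (x : V) (A U : Finset J) (i : J) (hAU : A ⊆ U)
    (hi : i ∉ U) :
    b (P (insert i A)ᶜ x) x - b (P Aᶜ x) x ≤ b (P (insert i U)ᶜ x) x - b (P Uᶜ x) x := by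
  have hidem : ∀ S y z, b (P S y) (P S z) = b (P S y) z := fun S y z => by
    rw [← hadj, hP, Finset.union_self]
  have hcontr : ∀ S y, b (P S y) (P S y) ≤ b y y := fun S y => by
    have h := two_mul_apply_le_of_isPosSemidef hb (P S y) y
    rw [← hidem] at h
    linarith
  have hincr : ∀ B, i ∉ B → b (P (insert i B)ᶜ x) x - b (P Bᶜ x) x =
      b (P (insert i B)ᶜ x - P Bᶜ x) (P (insert i B)ᶜ x - P Bᶜ x) := fun B hB => by
    have hU : (insert i B)ᶜ ∪ Bᶜ = Bᶜ := by ext; simp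
    have h1 : b (P (insert i B)ᶜ x) (P Bᶜ x) = b (P Bᶜ x) x := by
      rw [← hadj, hP, Finset.union_comm, hU]
    have h2 : b (P Bᶜ x) (P (insert i B)ᶜ x) = b (P Bᶜ x) x := by
      rw [← hadj, hP, hU]
    simp only [map_sub, LinearMap.sub_apply, hidem, h1, h2]
    ring
  rw [hincr A fun h => hi (hAU h), hincr U hi]
  have h1 : (insert i A)ᶜ ∪ (insert i U)ᶜ = (insert i A)ᶜ :=
    Finset.union_eq_left.mpr (Finset.compl_subset_compl.mpr (Finset.insert_subset_insert i hAU))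
  have h2 : (insert i A)ᶜ ∪ Uᶜ = Aᶜ := by
    ext j
    simp only [Finset.mem_union, Finset.mem_compl, Finset.mem_insert]
    have := @hAU j
    by_cases hj : j = i
    · subst hj; tauto
    · tauto
  have h3 := hcontr (insert i A)ᶜ (P (insert i U)ᶜ x - P Uᶜ x)
  rwa [map_sub, hP, hP, h1, h2] at h3

/-- Let `x` be invariant, as far as norms see, under a transitive permutation group of the sites.
Applying the projections on the sites in `T` leaves at most the fraction `|Tᶜ| / |J|` of the
squared norm of `x` beyond that of its full projection. -/
theorem card_mul_projection_le (hb : b.IsPosSemidef) [Fintype J]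
    {P : Finset J → V →ₗ[ℝ] V} (hP0 : ∀ x, P ∅ x = x)
    (hP : ∀ S T x, P S (P T x) = P (S ∪ T) x)
    (hadj : ∀ S x y, b (P S x) y = b x (P S y)) (x : V)
    (G : Subgroup (Equiv.Perm J)) (htrans : ∀ i j, ∃ g ∈ G, g i = j)
    (hinv : ∀ g ∈ G, ∀ T : Finset J, b (P (T.map g.toEmbedding) x) x = b (P T x) x)
    (T : Finset J) :
    (Fintype.card J : ℝ) * (b (P T x) x - b (P Finset.univ x) x) ≤
      Tᶜ.card * (b x x - b (P Finset.univ x) x) := by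
  have h := card_mul_le_of_supermodular_of_transitive (h := fun A => b (P Aᶜ x) x)
    (supermodular_of_projections hb hP hadj x) G htrans
    (fun g hg A => by
      have hA : (A.map g.toEmbedding)ᶜ = Aᶜ.map g.toEmbedding := by
        ext j
        simp
      rw [hA, hinv g hg Aᶜ]) Tᶜ
  simpa only [compl_compl, Finset.compl_empty, Finset.compl_univ, hP0] using h

end Form

/-! ### The semi-inner product of a state and its partial expectations -/

section StateForm

variable {η : Type*} [Fintype η]

/-- The real semi-inner product `Re Tr (R Xᴴ Y)` on operators. It is positive semidefinite when `R`
is, and may be degenerate. -/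
def stateForm (R : Matrix η η ℂ) : LinearMap.BilinForm ℝ (Matrix η η ℂ) :=
  LinearMap.mk₂ ℝ (fun X Y => (R * X.conjTranspose * Y).trace.re)
    (fun X Y Z => by simp [mul_add, add_mul])
    (fun c X Y => by simp)
    (fun X Y Z => by simp [mul_add])
    (fun c X Y => by simp)

theorem stateForm_apply (R X Y : Matrix η η ℂ) :
    stateForm R X Y = (R * X.conjTranspose * Y).trace.re := rfl

theorem stateForm_isPosSemidef {R : Matrix η η ℂ} (hR : R.PosSemidef) :
    (stateForm R).IsPosSemidef where
  eq X Y := by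
    rw [stateForm_apply, stateForm_apply]
    have h : (R * Y.conjTranspose * X).trace = star (R * X.conjTranspose * Y).trace := by
      rw [mul_assoc, Matrix.trace_mul_comm, ← Matrix.trace_conjTranspose,
        Matrix.conjTranspose_mul, Matrix.conjTranspose_mul, Matrix.conjTranspose_conjTranspose,
        hR.isHermitian.eq, mul_assoc]
    rw [h]
    simp
  nonneg X := by
    rw [stateForm_apply, mul_assoc, Matrix.trace_mul_comm, mul_assoc, Matrix.trace_mul_comm,
      mul_assoc, ← mul_assoc]
    exact (Complex.nonneg_iff.mp (hR.mul_mul_conjTranspose_same X).trace_nonneg).1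

variable [DecidableEq η]

/-- The map `N ↦ Tr (R N) 1`, the expectation of one site. -/
def expectationMap (R : Matrix η η ℂ) : Matrix η η ℂ →ₗ[ℂ] Matrix η η ℂ where
  toFun N := (R * N).trace • 1
  map_add' M N := by rw [mul_add, Matrix.trace_add, add_smul]
  map_smul' c N := by simp [mul_smul]

theorem expectationMap_apply (R N : Matrix η η ℂ) : expectationMap R N = (R * N).trace • 1 := rfl

end StateForm

section SiteExpectation

variable {ι κ : Type*} [Fintype ι] [Fintype κ] [DecidableEq ι] [DecidableEq κ] {d : ℕ}
  {R : Matrix (Fin d) (Fin d) ℂ}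

/-- The partial expectation `X ↦ Tr_S (R^{⊗S} X) ⊗ 1` of the sites in `S`, all in state `R`. -/
def siteExpectation (R : Matrix (Fin d) (Fin d) ℂ) (S : Finset ι) :
    Matrix (ι → Fin d) (ι → Fin d) ℂ →ₗ[ℂ] Matrix (ι → Fin d) (ι → Fin d) ℂ :=
  tensorMap fun i => if i ∈ S then expectationMap R else LinearMap.id

theorem siteExpectation_empty (X : Matrix (ι → Fin d) (ι → Fin d) ℂ) :
    siteExpectation R ∅ X = X := by
  simp only [siteExpectation, Finset.notMem_empty, if_false, tensorMap_id]

theorem expectationMap_one (hR : R.trace = 1) : expectationMap R 1 = 1 := by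
  rw [expectationMap_apply, mul_one, hR, one_smul]

theorem siteExpectation_siteExpectation (hR : R.trace = 1) (S T : Finset ι)
    (X : Matrix (ι → Fin d) (ι → Fin d) ℂ) :
    siteExpectation R S (siteExpectation R T X) = siteExpectation R (S ∪ T) X := by
  rw [siteExpectation, siteExpectation, siteExpectation, tensorMap_comp]
  congr 2
  funext i
  ext1 N
  by_cases hS : i ∈ S <;> by_cases hT : i ∈ T <;>
    simp [hS, hT, expectationMap_apply, hR]

theorem siteExpectation_univ (X : Matrix (ι → Fin d) (ι → Fin d) ℂ) :
    siteExpectation R Finset.univ X = (tensorMatrix (fun _ => R) * X).trace • 1 := by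
  induction X using tensorMatrix_induction with
  | hadd X Y hX hY => simp only [map_add, hX, hY, mul_add, Matrix.trace_add, add_smul]
  | hsmul c M =>
    rw [map_smul, siteExpectation, tensorMap_tensorMatrix, Matrix.mul_smul, tensorMatrix_mul,
      Matrix.trace_smul, trace_tensorMatrix, smul_assoc, ← tensorMatrix_one]
    congr 1
    ext a b
    simp [tensorMatrix, expectationMap_apply, Finset.prod_mul_distrib]

theorem conjTranspose_siteExpectation (hR : R.IsHermitian) (S : Finset ι)
    (X : Matrix (ι → Fin d) (ι → Fin d) ℂ) :
    (siteExpectation R S X).conjTranspose = siteExpectation R S X.conjTranspose := by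
  refine conjTranspose_tensorMap (fun i N => ?_) X
  split_ifs
  · rw [expectationMap_apply, expectationMap_apply, Matrix.conjTranspose_smul,
      Matrix.conjTranspose_one, ← Matrix.trace_conjTranspose, Matrix.conjTranspose_mul, hR.eq,
      Matrix.trace_mul_comm]
  · rfl

/-- Partial expectations are self-adjoint for the semi-inner product of the product state. -/
theorem stateForm_siteExpectation (hR : R.IsHermitian) (S : Finset ι)
    (X Y : Matrix (ι → Fin d) (ι → Fin d) ℂ) :
    stateForm (tensorMatrix fun _ => R) (siteExpectation R S X) Y =
      stateForm (tensorMatrix fun _ => R) X (siteExpectation R S Y) := by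
  rw [stateForm_apply, stateForm_apply, conjTranspose_siteExpectation hR]
  refine congrArg Complex.re (trace_tensorMatrix_mul_tensorMap (fun i M N => ?_) _ Y)
  split_ifs
  · simp only [expectationMap_apply, Matrix.mul_smul, Matrix.smul_mul, mul_one,
      Matrix.trace_smul, smul_eq_mul]
    exact mul_comm _ _
  · rfl

theorem siteExpectation_embedSites (hR : R.trace = 1) {f : κ → ι} (hf : f.Injective)
    (S : Finset ι) (X : Matrix (κ → Fin d) (κ → Fin d) ℂ) :
    siteExpectation R S (embedSites f X) =
      embedSites f (siteExpectation R (Finset.univ.filter fun j => f j ∈ S) X) := by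
  rw [siteExpectation, tensorMap_embedSites hf fun i => by
    split_ifs <;> simp [expectationMap_one hR]]
  simp [siteExpectation]

theorem stateForm_embedSites (hR : R.trace = 1) {f : κ → ι} (hf : f.Injective)
    (X Y : Matrix (κ → Fin d) (κ → Fin d) ℂ) :
    stateForm (tensorMatrix fun _ => R) (embedSites f X) (embedSites f Y) =
      stateForm (tensorMatrix fun _ => R) X Y := by
  rw [stateForm_apply, stateForm_apply, conjTranspose_embedSites, mul_assoc,
    ← embedSites_mul hf, trace_tensorMatrix_mul_embedSites hf fun _ => hR, mul_assoc]

end SiteExpectation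

/-! ### The symmetry of the channel -/

section Channel

variable {d : ℕ} (W : BSCQChannel d)

/-- The sign `(-1)ˣ` of a bit. -/
def bitSign (x : ZMod 2) : ℝ := if x = 0 then 1 else -1

theorem zmod_two_eq_zero_or_one (x : ZMod 2) : x = 0 ∨ x = 1 := by
  revert x
  decide

theorem bitSign_add (x y : ZMod 2) : bitSign (x + y) = bitSign x * bitSign y := by
  rcases zmod_two_eq_zero_or_one x with rfl | rfl <;>
    rcases zmod_two_eq_zero_or_one y with rfl | rfl <;>
      simp [bitSign, CharTwo.add_self_eq_zero]

theorem bitSign_mul_self (x : ZMod 2) : bitSign x * bitSign x = 1 := by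
  unfold bitSign
  split_ifs <;> norm_num

theorem exists_flip : ∃ u : ZMod 2 → Matrix (Fin d) (Fin d) ℂ,
    (∀ x, (u x).IsHermitian) ∧ (∀ x y, u x * u y = u (x + y)) ∧ u 0 = 1 ∧
      ∀ x, W.state x = u x * W.state 0 * u x := by
  obtain ⟨U, hU, hUU, hstate⟩ := W.symmetric
  have hH : U.conjTranspose = U := by
    have h := Matrix.mem_unitaryGroup_iff.mp hU
    calc U.conjTranspose = U * U * U.conjTranspose := by rw [hUU, one_mul]
      _ = U * (U * star U) := by rw [mul_assoc, Matrix.star_eq_conjTranspose]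
      _ = U := by rw [h, mul_one]
  refine ⟨fun x => if x = 0 then 1 else U, fun x => ?_, fun x y => ?_, if_pos rfl, fun x => ?_⟩
  · dsimp only
    split_ifs
    exacts [Matrix.isHermitian_one, hH]
  · rcases zmod_two_eq_zero_or_one x with rfl | rfl <;>
      rcases zmod_two_eq_zero_or_one y with rfl | rfl <;>
        simp [hUU, CharTwo.add_self_eq_zero]
  · rw [hH] at hstate
    rcases zmod_two_eq_zero_or_one x with rfl | rfl
    · simp
    · simpa using hstate

/-- Hermitian involutions `u x` (with `u 0 = 1`) carrying the output for the bit `0` to the output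
for the bit `x`. -/
def BSCQChannel.flip : ZMod 2 → Matrix (Fin d) (Fin d) ℂ := (exists_flip W).choose

theorem BSCQChannel.isHermitian_flip (x : ZMod 2) : (W.flip x).IsHermitian :=
  (exists_flip W).choose_spec.1 x

theorem BSCQChannel.flip_mul (x y : ZMod 2) : W.flip x * W.flip y = W.flip (x + y) :=
  (exists_flip W).choose_spec.2.1 x y

theorem BSCQChannel.flip_zero : W.flip 0 = 1 := (exists_flip W).choose_spec.2.2.1

theorem BSCQChannel.flip_mul_self (x : ZMod 2) : W.flip x * W.flip x = 1 := by
  rw [W.flip_mul, CharTwo.add_self_eq_zero, W.flip_zero]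

theorem BSCQChannel.state_eq (x : ZMod 2) : W.state x = W.flip x * W.state 0 * W.flip x :=
  (exists_flip W).choose_spec.2.2.2 x

variable {ι κ : Type*} [Fintype ι] [Fintype κ] [DecidableEq ι] [DecidableEq κ]

/-- Conjugation by the product of the flips `W.flip (x i)`. -/
def flipConj (x : ι → ZMod 2) :
    Matrix (ι → Fin d) (ι → Fin d) ℂ →ₗ[ℂ] Matrix (ι → Fin d) (ι → Fin d) ℂ :=
  tensorMap fun i => LinearMap.mulLeftRight ℂ (W.flip (x i), W.flip (x i))

theorem flipConj_one (x : ι → ZMod 2) : flipConj W x 1 = 1 :=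
  tensorMap_one fun i => by simp [W.flip_mul_self]

theorem flipConj_mul (x : ι → ZMod 2) (X Y : Matrix (ι → Fin d) (ι → Fin d) ℂ) :
    flipConj W x (X * Y) = flipConj W x X * flipConj W x Y := by
  refine tensorMap_mul (fun i M N => ?_) X Y
  simp only [LinearMap.mulLeftRight_apply]
  calc W.flip (x i) * (M * N) * W.flip (x i)
      = W.flip (x i) * M * 1 * N * W.flip (x i) := by simp only [mul_assoc, one_mul]
    _ = _ := by rw [← W.flip_mul_self (x i)]; simp only [mul_assoc]

theorem conjTranspose_flipConj (x : ι → ZMod 2) (X : Matrix (ι → Fin d) (ι → Fin d) ℂ) :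
    (flipConj W x X).conjTranspose = flipConj W x X.conjTranspose := by
  refine conjTranspose_tensorMap (fun i N => ?_) X
  simp only [LinearMap.mulLeftRight_apply, Matrix.conjTranspose_mul, (W.isHermitian_flip _).eq,
    mul_assoc]

theorem flipConj_flipConj (x y : ι → ZMod 2) (X : Matrix (ι → Fin d) (ι → Fin d) ℂ) :
    flipConj W x (flipConj W y X) = flipConj W (x + y) X := by
  rw [flipConj, flipConj, flipConj, tensorMap_comp]
  congr 2
  funext i
  ext1 N
  simp only [LinearMap.comp_apply, LinearMap.mulLeftRight_apply, Pi.add_apply]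
  rw [← W.flip_mul (x i) (y i), W.flip_mul (x i) (y i)]
  nth_rw 2 [add_comm (x i)]
  simp only [← W.flip_mul, mul_assoc]

/-- Flipping the observable amounts to sending another word. -/
theorem trace_mul_flipConj (x : ι → ZMod 2) (X : Matrix (ι → Fin d) (ι → Fin d) ℂ) :
    (tensorMatrix (fun _ => W.state 0) * flipConj W x X).trace =
      (tensorMatrix (fun i => W.state (x i)) * X).trace := by
  refine trace_tensorMatrix_mul_tensorMap_of_trace (fun i M => ?_) X
  rw [LinearMap.mulLeftRight_apply, W.state_eq (x i), ← mul_assoc, Matrix.trace_mul_comm]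
  simp only [mul_assoc]

theorem flipConj_embedSites {f : κ → ι} (hf : f.Injective) (x : ι → ZMod 2)
    (X : Matrix (κ → Fin d) (κ → Fin d) ℂ) :
    flipConj W x (embedSites f X) = embedSites f (flipConj W (x ∘ f) X) :=
  tensorMap_embedSites hf (fun i => by simp [W.flip_mul_self]) X

end Channel

/-! ### The mean-squared error of an observable -/

section Error

theorem bitSign_smul_single (x : ZMod 2) :
    Matrix.single x x (1 : ℂ) * (Matrix.single 0 0 1 - Matrix.single 1 1 1) =
      (bitSign x : ℂ) • Matrix.single x x 1 := by
  rcases zmod_two_eq_zero_or_one x with rfl | rfl <;>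
    simp [bitSign, mul_sub]

theorem trace_single_kronecker_mul_sq {η : Type*} [Fintype η] [DecidableEq η] (x : ZMod 2)
    (σ M : Matrix η η ℂ) :
    (Matrix.single x x (1 : ℂ) ⊗ₖ σ *
      (bitObservable η - (1 : Matrix (ZMod 2) (ZMod 2) ℂ) ⊗ₖ M) ^ 2).trace =
      (σ * ((bitSign x : ℂ) • 1 - M) * ((bitSign x : ℂ) • 1 - M)).trace := by
  have h : ∀ τ : Matrix η η ℂ, Matrix.single x x (1 : ℂ) ⊗ₖ τ *
      (bitObservable η - (1 : Matrix (ZMod 2) (ZMod 2) ℂ) ⊗ₖ M) =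
        Matrix.single x x (1 : ℂ) ⊗ₖ (τ * ((bitSign x : ℂ) • 1 - M)) := fun τ => by
    rw [bitObservable, mul_sub, ← Matrix.mul_kronecker_mul, ← Matrix.mul_kronecker_mul,
      bitSign_smul_single, mul_one, mul_one, mul_sub, Matrix.mul_smul, mul_one,
      Matrix.smul_kronecker, sub_eq_add_neg, sub_eq_add_neg, Matrix.kronecker_add,
      Matrix.kronecker_smul, ← neg_one_smul ℂ (τ * M), Matrix.kronecker_smul, neg_one_smul]
  rw [pow_two, ← mul_assoc, h, h, Matrix.trace_kronecker, Matrix.trace_single_eq_same, one_mul]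

variable {d : ℕ} (W : BSCQChannel d) {ι : Type*} [Fintype ι]

open Classical in
/-- The action of a word `c` on observables of the bits other than `i₀`: flip the channel outputs
according to `c` and change the sign of the observable according to `c i₀`. -/
def twist (i₀ : ι) (c : ι → ZMod 2) :
    Matrix ({i // i ≠ i₀} → Fin d) ({i // i ≠ i₀} → Fin d) ℂ →ₗ[ℝ]
      Matrix ({i // i ≠ i₀} → Fin d) ({i // i ≠ i₀} → Fin d) ℂ :=
  bitSign (c i₀) • (flipConj W fun i : {i // i ≠ i₀} => c i).restrictScalars ℝ

open Classical in
theorem twist_apply (i₀ : ι) (c : ι → ZMod 2)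
    (M : Matrix ({i // i ≠ i₀} → Fin d) ({i // i ≠ i₀} → Fin d) ℂ) :
    twist W i₀ c M = bitSign (c i₀) • flipConj W (fun i : {i // i ≠ i₀} => c i) M := rfl

open Classical in
theorem twist_twist (i₀ : ι) (c c' : ι → ZMod 2)
    (M : Matrix ({i // i ≠ i₀} → Fin d) ({i // i ≠ i₀} → Fin d) ℂ) :
    twist W i₀ c (twist W i₀ c' M) = twist W i₀ (c + c') M := by
  rw [twist_apply, twist_apply, twist_apply, LinearMap.map_smul_of_tower, flipConj_flipConj,
    smul_smul, Pi.add_apply, bitSign_add]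
  rfl

open Classical in
theorem isHermitian_twist (i₀ : ι) (c : ι → ZMod 2)
    {M : Matrix ({i // i ≠ i₀} → Fin d) ({i // i ≠ i₀} → Fin d) ℂ} (hM : M.IsHermitian) :
    (twist W i₀ c M).IsHermitian := by
  rw [twist_apply, Matrix.IsHermitian, Matrix.conjTranspose_smul, conjTranspose_flipConj, hM.eq]
  simp

open Classical in
/-- The semi-inner product of the channel outputs for the zero word, at the bits other than
`i₀`. -/
def zeroForm (i₀ : ι) :
    LinearMap.BilinForm ℝ (Matrix ({i // i ≠ i₀} → Fin d) ({i // i ≠ i₀} → Fin d) ℂ) :=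
  stateForm (tensorMatrix fun _ => W.state 0)

open Classical in
theorem zeroForm_isPosSemidef (i₀ : ι) : (zeroForm W i₀).IsPosSemidef :=
  stateForm_isPosSemidef (posSemidef_tensorMatrix fun _ => W.posSemidef 0)

open Classical in
theorem zeroForm_one_one (i₀ : ι) : zeroForm W i₀ 1 1 = 1 := by
  simp [zeroForm, stateForm_apply, trace_tensorMatrix, W.trace_eq_one]

open Classical in
/-- By the symmetry of the channel, the error of an observable is the average over the codewords of
the errors, for the zero word, of its twists. -/
theorem meanSquaredError_extrinsicState (𝒞 : Submodule (ZMod 2) (ι → ZMod 2)) (i₀ : ι)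
    {M : Matrix ({i // i ≠ i₀} → Fin d) ({i // i ≠ i₀} → Fin d) ℂ} (hM : M.IsHermitian) :
    meanSquaredError (extrinsicState W 𝒞 i₀) M =
      ((Finset.univ.filter (· ∈ 𝒞)).card : ℝ)⁻¹ * ∑ c : ι → ZMod 2 with c ∈ 𝒞,
        zeroForm W i₀ (1 - twist W i₀ c M) (1 - twist W i₀ c M) := by
  have hcard : (Nat.card 𝒞 : ℂ) = ((Finset.univ.filter (· ∈ 𝒞)).card : ℝ) := by
    rw [Nat.card_eq_fintype_card, Fintype.card_subtype]
    simp
  have hterm : ∀ c : ι → ZMod 2,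
      (tensorMatrix (fun i : {i : ι // i ≠ i₀} => W.state (c i)) *
        ((bitSign (c i₀) : ℂ) • 1 - M) * ((bitSign (c i₀) : ℂ) • 1 - M)).trace.re =
      zeroForm W i₀ (1 - twist W i₀ c M) (1 - twist W i₀ c M) := fun c => by
    have hflip : flipConj W (fun i : {i : ι // i ≠ i₀} => c i) ((bitSign (c i₀) : ℂ) • 1 - M) =
        (bitSign (c i₀) : ℂ) • (1 - twist W i₀ c M) := by
      rw [map_sub, map_smul, flipConj_one, smul_sub, twist_apply, ← Complex.coe_smul, smul_smul,
        ← Complex.ofReal_mul, bitSign_mul_self, Complex.ofReal_one, one_smul]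
    rw [mul_assoc, ← trace_mul_flipConj W (fun i : {i : ι // i ≠ i₀} => c i), flipConj_mul, hflip,
      Matrix.smul_mul, Matrix.mul_smul, Matrix.mul_smul, Matrix.mul_smul, smul_smul,
      ← Complex.ofReal_mul, bitSign_mul_self, Complex.ofReal_one, one_smul, zeroForm,
      stateForm_apply, (Matrix.isHermitian_one.sub (isHermitian_twist W i₀ c hM)).eq, mul_assoc]
  rw [meanSquaredError, extrinsicState, hcard, ← Complex.ofReal_inv, Matrix.smul_mul,
    Matrix.trace_smul, smul_eq_mul, Complex.re_ofReal_mul, Finset.sum_mul, Matrix.trace_sum,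
    Complex.re_sum]
  congr 1
  refine Finset.sum_congr rfl fun c _ => ?_
  rw [trace_single_kronecker_mul_sq, hterm]

end Error

/-! ### Correlation of two copies of a symmetric observable -/

section Correlation

variable {ι κ : Type*} [Fintype ι] [Fintype κ] [DecidableEq ι] [DecidableEq κ] {d : ℕ}
  {R : Matrix (Fin d) (Fin d) ℂ}

theorem stateForm_siteExpectation_univ (hR : R.PosSemidef)
    {M : Matrix (ι → Fin d) (ι → Fin d) ℂ} (hM : M.IsHermitian) :
    stateForm (tensorMatrix fun _ => R) (siteExpectation R Finset.univ M) M =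
      stateForm (tensorMatrix fun _ => R) 1 M ^ 2 := by
  have hreal : star (tensorMatrix (fun _ : ι => R) * M).trace =
      (tensorMatrix (fun _ : ι => R) * M).trace := by
    rw [← Matrix.trace_conjTranspose, Matrix.conjTranspose_mul, hM.eq,
      (posSemidef_tensorMatrix fun _ : ι => hR).isHermitian.eq, Matrix.trace_mul_comm]
  have him := Complex.conj_eq_iff_im.mp hreal
  rw [siteExpectation_univ, stateForm_apply, stateForm_apply, Matrix.conjTranspose_smul,
    Matrix.conjTranspose_one, mul_one, Matrix.mul_smul, mul_one, Matrix.smul_mul,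
    Matrix.trace_smul, hreal, smul_eq_mul, Complex.mul_re, him, pow_two, mul_zero, sub_zero]

/-- Let `M` be an observable on `κ`, invariant under a transitive permutation group. Two copies of
it, placed on the sites `f₁ κ` and `f₂ κ`, correlate only through the common sites, and these carry
at most the proportional share of the variance of `M`. -/
theorem card_mul_stateForm_embedSites_le (hR : R.PosSemidef) (htr : R.trace = 1)
    {f₁ f₂ : κ → ι} (hf₁ : f₁.Injective) (hf₂ : f₂.Injective)
    {M : Matrix (κ → Fin d) (κ → Fin d) ℂ} (hM : M.IsHermitian)
    (G : Subgroup (Equiv.Perm κ)) (htrans : ∀ i j, ∃ g ∈ G, g i = j)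
    (hinv : ∀ g ∈ G, embedSites g M = M) {a : ℕ}
    (ha₁ : (Finset.univ.filter fun j => f₁ j ∈ Finset.univ.image f₂).card = a)
    (ha₂ : (Finset.univ.filter fun j => f₂ j ∈ Finset.univ.image f₁).card = a) :
    (Fintype.card κ : ℝ) * (stateForm (tensorMatrix fun _ => R) (embedSites f₁ M)
        (embedSites f₂ M) - stateForm (tensorMatrix fun _ => R) 1 M ^ 2) ≤
      a * (stateForm (tensorMatrix fun _ => R) M M -
        stateForm (tensorMatrix fun _ => R) 1 M ^ 2) := by
  have hbι := stateForm_isPosSemidef (posSemidef_tensorMatrix fun _ : ι => hR)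
  have hbκ := stateForm_isPosSemidef (posSemidef_tensorMatrix fun _ : κ => hR)
  have hsq : ∀ (S : Finset κ), stateForm (tensorMatrix fun _ => R) (siteExpectation R S M)
      (siteExpectation R S M) =
        stateForm (tensorMatrix fun _ => R) (siteExpectation R S M) M := fun S => by
    rw [← stateForm_siteExpectation hR.isHermitian, siteExpectation_siteExpectation htr,
      Finset.union_self]
  have hbound : ∀ T : Finset κ, Tᶜ.card = a →
      (Fintype.card κ : ℝ) * (stateForm (tensorMatrix fun _ => R) (siteExpectation R T M) M -
        stateForm (tensorMatrix fun _ => R) 1 M ^ 2) ≤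
      a * (stateForm (tensorMatrix fun _ => R) M M -
        stateForm (tensorMatrix fun _ => R) 1 M ^ 2) := fun T hT => by
    rw [← stateForm_siteExpectation_univ hR hM, ← hT]
    refine card_mul_projection_le hbκ
      (P := fun S => (siteExpectation R S).restrictScalars ℝ) siteExpectation_empty
      (siteExpectation_siteExpectation htr)
      (stateForm_siteExpectation hR.isHermitian) M G htrans (fun g hg T => ?_) T
    have hT : (Finset.univ.filter fun j => g j ∈ T.map g.toEmbedding) = T := by
      ext j
      simp
    have h := siteExpectation_embedSites htr g.injective (T.map g.toEmbedding) M
    rw [hinv g hg, hT] at h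
    calc stateForm (tensorMatrix fun _ => R) (siteExpectation R (T.map g.toEmbedding) M) M
        = stateForm (tensorMatrix fun _ => R) (embedSites g (siteExpectation R T M))
            (embedSites g M) := by rw [h, hinv g hg]
      _ = _ := stateForm_embedSites htr g.injective _ _
  -- Each copy is unaffected by the expectation of the sites it does not touch.
  have hfix : ∀ {f : κ → ι} (_ : f.Injective),
      siteExpectation R (Finset.univ.image f)ᶜ (embedSites f M) = embedSites f M := fun hf => by
    rw [siteExpectation_embedSites htr hf]
    simp [siteExpectation_empty]
  have hnorm : ∀ {f g : κ → ι} (_ : f.Injective),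
      (Finset.univ.filter fun j => f j ∈ Finset.univ.image g).card = a →
      (Fintype.card κ : ℝ) * (stateForm (tensorMatrix fun _ => R)
        (siteExpectation R (Finset.univ.image g)ᶜ (embedSites f M))
        (siteExpectation R (Finset.univ.image g)ᶜ (embedSites f M)) -
          stateForm (tensorMatrix fun _ => R) 1 M ^ 2) ≤
      a * (stateForm (tensorMatrix fun _ => R) M M -
        stateForm (tensorMatrix fun _ => R) 1 M ^ 2) := fun {f g} hf hcard => by
    rw [siteExpectation_embedSites htr hf, stateForm_embedSites htr hf, hsq]
    refine hbound _ ?_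
    rw [← hcard]
    congr 1
    ext j
    simp
  have hcross : stateForm (tensorMatrix fun _ => R) (embedSites f₁ M) (embedSites f₂ M) =
      stateForm (tensorMatrix fun _ => R)
        (siteExpectation R (Finset.univ.image f₂)ᶜ (embedSites f₁ M))
        (siteExpectation R (Finset.univ.image f₁)ᶜ (embedSites f₂ M)) := by
    rw [stateForm_siteExpectation hR.isHermitian, siteExpectation_siteExpectation htr,
      Finset.union_comm, ← siteExpectation_siteExpectation htr, hfix hf₂,
      ← stateForm_siteExpectation hR.isHermitian, hfix hf₁]
  have h := two_mul_apply_le_of_isPosSemidef hbι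
    (siteExpectation R (Finset.univ.image f₂)ᶜ (embedSites f₁ M))
    (siteExpectation R (Finset.univ.image f₁)ᶜ (embedSites f₂ M))
  rw [← hcross] at h
  have h' := mul_le_mul_of_nonneg_left h (Nat.cast_nonneg (α := ℝ) (Fintype.card κ))
  have h₁ := hnorm hf₁ ha₁
  have h₂ := hnorm hf₂ ha₂
  linarith

end Correlation

/-! ### Symmetrization of an observable -/

section Symmetrization

variable {d : ℕ} (W : BSCQChannel d) {ι : Type*} [Fintype ι]

open Classical in
/-- The permutations of the coordinates other than `i₀` which preserve the code. -/
def extrinsicSymmetry (𝒞 : Submodule (ZMod 2) (ι → ZMod 2)) (i₀ : ι) :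
    Subgroup (Equiv.Perm {i // i ≠ i₀}) where
  carrier := {σ | ∀ c : ι → ZMod 2, c ∘ Equiv.Perm.ofSubtype σ ∈ 𝒞 ↔ c ∈ 𝒞}
  one_mem' c := by simp
  mul_mem' {σ τ} hσ hτ c := by
    rw [map_mul, Equiv.Perm.coe_mul, ← Function.comp_assoc]
    exact (hτ _).trans (hσ c)
  inv_mem' {σ} hσ c := by
    rw [← hσ, Function.comp_assoc, ← Equiv.Perm.coe_mul, ← map_mul, inv_mul_cancel, map_one,
      Equiv.Perm.coe_one, Function.comp_id]

theorem embedSites_perm_apply {κ : Type*} (σ : Equiv.Perm κ)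
    (X : Matrix (κ → Fin d) (κ → Fin d) ℂ) (a b : κ → Fin d) :
    embedSites σ X a b = X (a ∘ σ) (b ∘ σ) :=
  if_pos fun i hi => (hi (σ.surjective i)).elim

theorem embedSites_perm_mul {κ : Type*} (σ τ : Equiv.Perm κ)
    (X : Matrix (κ → Fin d) (κ → Fin d) ℂ) :
    embedSites (σ * τ : Equiv.Perm κ) X = embedSites σ (embedSites τ X) := by
  ext a b
  rw [embedSites_perm_apply, embedSites_perm_apply, embedSites_perm_apply]
  rfl

open Classical in
theorem twist_embedSites {κ : Type*} [Fintype κ] {i₀ : ι} {k₀ : κ}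
    {f : {k // k ≠ k₀} → {i // i ≠ i₀}} (hf : f.Injective) {c : ι → ZMod 2} {c' : κ → ZMod 2}
    (h₀ : c' k₀ = c i₀) (hc : ∀ j : {k // k ≠ k₀}, c' j = c (f j))
    (M : Matrix ({k // k ≠ k₀} → Fin d) ({k // k ≠ k₀} → Fin d) ℂ) :
    twist W i₀ c (embedSites f M) = embedSites f (twist W k₀ c' M) := by
  have hcf : (fun i : {i // i ≠ i₀} => c i) ∘ f = fun j : {k // k ≠ k₀} => c' j :=
    funext fun j => (hc j).symm
  rw [twist_apply, twist_apply, flipConj_embedSites W hf, hcf, h₀]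
  exact ((embedSites f).map_smul_of_tower (bitSign (c i₀)) _).symm

open Classical in
theorem zeroForm_one_sub_embedSites {i₀ : ι} (σ : Equiv.Perm {i // i ≠ i₀})
    (M : Matrix ({i // i ≠ i₀} → Fin d) ({i // i ≠ i₀} → Fin d) ℂ) :
    zeroForm W i₀ (1 - embedSites σ M) (1 - embedSites σ M) =
      zeroForm W i₀ (1 - M) (1 - M) := by
  have h : 1 - embedSites σ M = embedSites σ (1 - M) := by
    rw [map_sub, embedSites_one σ.injective]
  rw [h, zeroForm, stateForm_embedSites (W.trace_eq_one 0) σ.injective]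

theorem inv_card_smul_sum_one_sub {η α : Type*} [DecidableEq η] {s : Finset α}
    (hs : s.Nonempty) (y : α → Matrix η η ℂ) :
    (s.card : ℝ)⁻¹ • ∑ x ∈ s, (1 - y x) = 1 - (s.card : ℝ)⁻¹ • ∑ x ∈ s, y x := by
  have hne : (s.card : ℝ) ≠ 0 := by exact_mod_cast hs.card_pos.ne'
  rw [Finset.sum_sub_distrib, smul_sub, Finset.sum_const, ← Nat.cast_smul_eq_nsmul ℝ,
    smul_smul, inv_mul_cancel₀ hne, one_smul]

theorem isHermitian_smul_sum {η α : Type*} (s : Finset α) (r : ℝ) {y : α → Matrix η η ℂ}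
    (hy : ∀ x, (y x).IsHermitian) : (r • ∑ x ∈ s, y x).IsHermitian := by
  rw [Matrix.IsHermitian, Matrix.conjTranspose_smul, Matrix.conjTranspose_sum]
  simp only [(hy _).eq, star_trivial]

open Classical in
/-- Averaging over the codewords makes an observable covariant, and its error for the zero word is
at most the error of the original observable. -/
theorem exists_covariant_observable (𝒞 : Submodule (ZMod 2) (ι → ZMod 2)) (i₀ : ι)
    {M : Matrix ({i // i ≠ i₀} → Fin d) ({i // i ≠ i₀} → Fin d) ℂ} (hM : M.IsHermitian) :
    ∃ M' : Matrix ({i // i ≠ i₀} → Fin d) ({i // i ≠ i₀} → Fin d) ℂ, M'.IsHermitian ∧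
      (∀ c ∈ 𝒞, twist W i₀ c M' = M') ∧
      zeroForm W i₀ (1 - M') (1 - M') ≤ meanSquaredError (extrinsicState W 𝒞 i₀) M := by
  set s : Finset (ι → ZMod 2) := Finset.univ.filter (· ∈ 𝒞) with hs
  have hsne : s.Nonempty := ⟨0, by simp [hs, 𝒞.zero_mem]⟩
  refine ⟨(s.card : ℝ)⁻¹ • ∑ c ∈ s, twist W i₀ c M,
    isHermitian_smul_sum s _ fun c => isHermitian_twist W i₀ c hM, fun c hc => ?_, ?_⟩
  · rw [map_smul, map_sum]
    congr 1
    simp only [twist_twist]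
    refine Finset.sum_equiv (Equiv.addLeft c) (fun x => ?_) fun x _ => rfl
    simp [hs, 𝒞.add_mem_iff_right hc]
  · rw [meanSquaredError_extrinsicState W 𝒞 i₀ hM, ← inv_card_smul_sum_one_sub hsne]
    exact apply_average_le_of_isPosSemidef (zeroForm_isPosSemidef W i₀) s hsne _

open Classical in
/-- Averaging a covariant observable over the symmetries of the code does not increase its error
for the zero word. -/
theorem exists_invariant_observable (𝒞 : Submodule (ZMod 2) (ι → ZMod 2)) (i₀ : ι)
    {M : Matrix ({i // i ≠ i₀} → Fin d) ({i // i ≠ i₀} → Fin d) ℂ} (hM : M.IsHermitian)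
    (hMc : ∀ c ∈ 𝒞, twist W i₀ c M = M) :
    ∃ M' : Matrix ({i // i ≠ i₀} → Fin d) ({i // i ≠ i₀} → Fin d) ℂ, M'.IsHermitian ∧
      (∀ c ∈ 𝒞, twist W i₀ c M' = M') ∧
      (∀ σ ∈ extrinsicSymmetry 𝒞 i₀, embedSites σ M' = M') ∧
      zeroForm W i₀ (1 - M') (1 - M') ≤ zeroForm W i₀ (1 - M) (1 - M) := by
  set t : Finset (extrinsicSymmetry 𝒞 i₀) := Finset.univ with ht
  have htne : t.Nonempty := Finset.univ_nonempty
  refine ⟨(t.card : ℝ)⁻¹ • ∑ σ ∈ t, embedSites σ.1 M,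
    isHermitian_smul_sum t _ fun σ => ?_, fun c hc => ?_, fun σ hσ => ?_, ?_⟩
  · rw [Matrix.IsHermitian, conjTranspose_embedSites, hM.eq]
  · rw [map_smul, map_sum]
    congr 1
    refine Finset.sum_congr rfl fun σ _ => ?_
    rw [twist_embedSites W σ.1.injective (c' := c ∘ Equiv.Perm.ofSubtype σ.1),
      hMc _ ((σ.2 c).mpr hc)]
    · rw [Function.comp_apply, Equiv.Perm.ofSubtype_apply_of_not_mem _ (by simp)]
    · intro j
      rw [Function.comp_apply, Equiv.Perm.ofSubtype_apply_coe]
  · rw [(embedSites σ).map_smul_of_tower, map_sum]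
    congr 1
    refine Finset.sum_equiv (Equiv.mulLeft ⟨σ, hσ⟩) (fun _ => by simp [ht]) fun τ _ => ?_
    exact (embedSites_perm_mul σ τ.1 M).symm
  · rw [← inv_card_smul_sum_one_sub htne]
    refine (apply_average_le_of_isPosSemidef (zeroForm_isPosSemidef W i₀) t htne _).trans_eq ?_
    have hne : (t.card : ℝ) ≠ 0 := by exact_mod_cast htne.card_pos.ne'
    rw [Finset.sum_congr rfl fun σ _ => zeroForm_one_sub_embedSites W σ.1 M, Finset.sum_const,
      nsmul_eq_mul, inv_mul_cancel_left₀ hne]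

/-- The optimal multiple `r • y` of `y` as an approximation of a unit vector `x`: its error is
`1 - ⟨r • y, r • y⟩`. -/
theorem exists_smul_optimal {V : Type*} [AddCommGroup V] [Module ℝ V] {b : LinearMap.BilinForm ℝ V}
    (hb : b.IsPosSemidef) {x : V} (hx : b x x = 1) (y : V) :
    ∃ r : ℝ, b x (r • y) = b (r • y) (r • y) ∧ 1 - b (r • y) (r • y) ≤ b (x - y) (x - y) := by
  have hexpand : ∀ r : ℝ, b (x - r • y) (x - r • y) =
      1 - 2 * r * b x y + r ^ 2 * b y y := fun r => by
    have hyx : b y x = b x y := (hb.eq x y).symm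
    simp only [map_sub, LinearMap.sub_apply, map_smul, LinearMap.smul_apply, smul_eq_mul, hx, hyx]
    ring
  have hrr : ∀ r : ℝ, b (r • y) (r • y) = r ^ 2 * b y y := fun r => by
    simp only [map_smul, LinearMap.smul_apply, smul_eq_mul]
    ring
  have h1 := hexpand 1
  rw [one_smul] at h1
  rcases (hb.nonneg y).eq_or_lt with h0 | hpos
  · -- A vector of norm zero is orthogonal to `x`.
    have hq : b x y = 0 := by
      by_contra hne
      have h := hb.nonneg (x - (b x y)⁻¹ • y)
      rw [hexpand, ← h0, mul_assoc, inv_mul_cancel₀ hne] at h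
      linarith
    refine ⟨0, by simp, ?_⟩
    rw [h1, hq, ← h0]
    simp
  · refine ⟨b x y / b y y, ?_, ?_⟩
    · rw [hrr, map_smul, smul_eq_mul]
      field_simp
    · have h : 0 ≤ (b x y - b y y) ^ 2 / b y y := by positivity
      have h2 : (b x y - b y y) ^ 2 / b y y =
          (b x y / b y y) ^ 2 * b y y - 2 * b x y + b y y := by
        field_simp
        ring
      rw [h1, hrr]
      linarith

open Classical in
/-- Every observable can be replaced, without increasing its error, by one that is covariant under
the codewords, invariant under the symmetries of the code, and of error `1 - ⟨M', M'⟩`. -/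
theorem exists_symmetric_observable (𝒞 : Submodule (ZMod 2) (ι → ZMod 2)) (i₀ : ι)
    {M : Matrix ({i // i ≠ i₀} → Fin d) ({i // i ≠ i₀} → Fin d) ℂ} (hM : M.IsHermitian) :
    ∃ M' : Matrix ({i // i ≠ i₀} → Fin d) ({i // i ≠ i₀} → Fin d) ℂ, M'.IsHermitian ∧
      (∀ c ∈ 𝒞, twist W i₀ c M' = M') ∧
      (∀ σ ∈ extrinsicSymmetry 𝒞 i₀, embedSites σ M' = M') ∧
      zeroForm W i₀ 1 M' = zeroForm W i₀ M' M' ∧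
      1 - zeroForm W i₀ M' M' ≤ meanSquaredError (extrinsicState W 𝒞 i₀) M := by
  obtain ⟨M₁, hM₁, hc₁, he₁⟩ := exists_covariant_observable W 𝒞 i₀ hM
  obtain ⟨M₂, hM₂, hc₂, hs₂, he₂⟩ := exists_invariant_observable W 𝒞 i₀ hM₁ hc₁
  obtain ⟨r, hr, he⟩ :=
    exists_smul_optimal (zeroForm_isPosSemidef W i₀) (zeroForm_one_one W i₀) M₂
  refine ⟨r • M₂, ?_, fun c hc => ?_, fun σ hσ => ?_, hr, he.trans (he₂.trans he₁)⟩
  · rw [Matrix.IsHermitian, Matrix.conjTranspose_smul, hM₂.eq, star_trivial]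
  · rw [map_smul, hc₂ c hc]
  · rw [(embedSites σ).map_smul_of_tower, hs₂ σ hσ]

end Symmetrization

/-! ### The bound for a code with two overlapping projections -/

section TwoLooks

theorem apply_sub_average_of_isPosSemidef {V : Type*} [AddCommGroup V] [Module ℝ V]
    {b : LinearMap.BilinForm ℝ V} (hb : b.IsPosSemidef) {x y z : V} {p : ℝ} (hx : b x x = 1)
    (hxy : b x y = p) (hxz : b x z = p) (hy : b y y = p) (hz : b z z = p) :
    b (x - (1 / 2 : ℝ) • (y + z)) (x - (1 / 2 : ℝ) • (y + z)) =
      1 - 3 / 2 * p + 1 / 2 * b y z := by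
  have hyx : b y x = p := (hb.eq y x).trans hxy
  have hzx : b z x = p := (hb.eq z x).trans hxz
  have hzy : b z y = b y z := hb.eq z y
  simp only [map_sub, map_add, LinearMap.sub_apply, LinearMap.add_apply, map_smul,
    LinearMap.smul_apply, smul_eq_mul, hx, hxy, hxz, hyx, hzx, hzy, hy, hz]
  ring

open Classical in
theorem card_filter_mem_image_eq_ncard {ι κ : Type*} [Fintype κ]
    {e e' : κ → ι} (he : e.Injective) {i₀ : ι} {k₀ : κ}
    (h : e k₀ = i₀) (h' : e' k₀ = i₀) {f f' : {k // k ≠ k₀} → {i // i ≠ i₀}}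
    (hf : ∀ k, (f k : ι) = e k) (hf' : ∀ k, (f' k : ι) = e' k) :
    (Finset.univ.filter fun j => f j ∈ Finset.univ.image f').card =
      ((Set.range e ∩ Set.range e') \ {i₀}).ncard := by
  rw [← Set.ncard_coe_finset, ← Set.ncard_image_of_injective _
    (he.comp Subtype.val_injective)]
  congr 1
  ext i
  simp only [Finset.coe_filter, Finset.mem_univ, true_and, Finset.mem_image, Set.mem_image,
    Set.mem_ofPred_eq, Set.mem_sdiff, Set.mem_inter_iff, Set.mem_range, Set.mem_singleton_iff,
    Function.comp_apply, Subtype.ext_iff, hf, hf']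
  constructor
  · rintro ⟨k, ⟨k', hk'⟩, rfl⟩
    exact ⟨⟨⟨k, rfl⟩, ⟨k', hk'⟩⟩, hf k ▸ (f k).2⟩
  · rintro ⟨⟨⟨k, rfl⟩, ⟨k', hk'⟩⟩, hi⟩
    have hk : k ≠ k₀ := fun hk => hi (hk ▸ h)
    have hk'0 : k' ≠ k₀ := fun hk0 => hi (by rw [← hk', hk0, h'])
    exact ⟨⟨k, hk⟩, ⟨⟨k', hk'0⟩, hk'⟩, rfl⟩

variable {d : ℕ} (W : BSCQChannel d) {ι κ : Type*} [Fintype ι] [Fintype κ]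

open Classical in
theorem zeroForm_embedSites {i₀ : ι} {k₀ : κ} {f : {k // k ≠ k₀} → {i // i ≠ i₀}}
    (hf : f.Injective) (X Y : Matrix ({k // k ≠ k₀} → Fin d) ({k // k ≠ k₀} → Fin d) ℂ) :
    zeroForm W i₀ (embedSites f X) (embedSites f Y) = zeroForm W k₀ X Y :=
  stateForm_embedSites (W.trace_eq_one 0) hf X Y

open Classical in
theorem meanSquaredError_extrinsicState_nonneg (𝒞 : Submodule (ZMod 2) (ι → ZMod 2)) (i₀ : ι)
    {M : Matrix ({i // i ≠ i₀} → Fin d) ({i // i ≠ i₀} → Fin d) ℂ} (hM : M.IsHermitian) :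
    0 ≤ meanSquaredError (extrinsicState W 𝒞 i₀) M := by
  rw [meanSquaredError_extrinsicState W 𝒞 i₀ hM]
  exact mul_nonneg (by positivity)
    (Finset.sum_nonneg fun _ _ => (zeroForm_isPosSemidef W i₀).nonneg _)

open Classical in
theorem bddBelow_meanSquaredError (𝒞 : Submodule (ZMod 2) (ι → ZMod 2)) (i₀ : ι) :
    BddBelow (Set.range fun M : {M : Matrix ({i // i ≠ i₀} → Fin d) ({i // i ≠ i₀} → Fin d) ℂ //
      M.IsHermitian} => meanSquaredError (extrinsicState W 𝒞 i₀) M.1) :=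
  ⟨0, by rintro _ ⟨M, rfl⟩; exact meanSquaredError_extrinsicState_nonneg W 𝒞 i₀ M.2⟩

open Classical in
theorem extrinsicMMSE_le_of_covariant (𝒞 : Submodule (ZMod 2) (ι → ZMod 2)) (i₀ : ι)
    {M : Matrix ({i // i ≠ i₀} → Fin d) ({i // i ≠ i₀} → Fin d) ℂ} (hM : M.IsHermitian)
    (hMc : ∀ c ∈ 𝒞, twist W i₀ c M = M) :
    extrinsicMMSE W 𝒞 i₀ ≤ zeroForm W i₀ (1 - M) (1 - M) := by
  refine (ciInf_le (bddBelow_meanSquaredError W 𝒞 i₀) ⟨M, hM⟩).trans_eq ?_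
  have hne : ((Finset.univ.filter (· ∈ 𝒞)).card : ℝ) ≠ 0 := by
    have : (Finset.univ.filter (· ∈ 𝒞)).Nonempty := ⟨0, by simp [𝒞.zero_mem]⟩
    exact_mod_cast this.card_pos.ne'
  rw [meanSquaredError_extrinsicState W 𝒞 i₀ hM, Finset.sum_congr rfl fun c hc => by
    rw [hMc c (Finset.mem_filter.mp hc).2], Finset.sum_const, nsmul_eq_mul,
    inv_mul_cancel_left₀ hne]

open Classical in
/-- The average of the two copies of a symmetric observable of error `1 - p` has error at most
`(1 + κ) / 2 * (1 - p) + (1 - κ) / 2 * (1 - p) ^ 2`, where `κ = a / n` is the fraction of common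
positions. -/
theorem extrinsicMMSE_le_of_symmetric_observable {𝒞 : Submodule (ZMod 2) (ι → ZMod 2)}
    {𝒟 : Submodule (ZMod 2) (κ → ZMod 2)} {i₀ : ι} {k₀ : κ} {e₁ e₂ : κ → ι}
    (he₁ : e₁.Injective) (he₂ : e₂.Injective) (h₁ : e₁ k₀ = i₀) (h₂ : e₂ k₀ = i₀)
    (hC₁ : ∀ c ∈ 𝒞, c ∘ e₁ ∈ 𝒟) (hC₂ : ∀ c ∈ 𝒞, c ∘ e₂ ∈ 𝒟)
    (htrans : ∀ i j : {k // k ≠ k₀}, ∃ g ∈ extrinsicSymmetry 𝒟 k₀, g i = j) {a n : ℕ}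
    (ha : ((Set.range e₁ ∩ Set.range e₂) \ {i₀}).ncard = a) (hn : Nat.card {k // k ≠ k₀} = n)
    (hn0 : n ≠ 0)
    {M : Matrix ({k // k ≠ k₀} → Fin d) ({k // k ≠ k₀} → Fin d) ℂ} (hM : M.IsHermitian)
    (hMc : ∀ c ∈ 𝒟, twist W k₀ c M = M)
    (hMs : ∀ σ ∈ extrinsicSymmetry 𝒟 k₀, embedSites σ M = M)
    (hp : zeroForm W k₀ 1 M = zeroForm W k₀ M M) :
    extrinsicMMSE W 𝒞 i₀ ≤ (1 + (a : ℝ) / n) / 2 * (1 - zeroForm W k₀ M M) +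
      (1 - (a : ℝ) / n) / 2 * (1 - zeroForm W k₀ M M) ^ 2 := by
  -- The inclusions of the positions other than the decoded one.
  have hne : ∀ {e : κ → ι}, e.Injective → e k₀ = i₀ → ∀ k : {k // k ≠ k₀}, e k ≠ i₀ :=
    fun he h k hk => k.2 (he (hk.trans h.symm))
  let f₁ : {k // k ≠ k₀} → {i // i ≠ i₀} := fun k => ⟨e₁ k, hne he₁ h₁ k⟩
  let f₂ : {k // k ≠ k₀} → {i // i ≠ i₀} := fun k => ⟨e₂ k, hne he₂ h₂ k⟩
  have hf₁ : f₁.Injective := fun x y h => Subtype.ext (he₁ (congrArg Subtype.val h))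
  have hf₂ : f₂.Injective := fun x y h => Subtype.ext (he₂ (congrArg Subtype.val h))
  set X₁ := embedSites f₁ M with hX₁
  set X₂ := embedSites f₂ M with hX₂
  set p := zeroForm W k₀ M M with hpdef
  have hb := zeroForm_isPosSemidef W i₀
  have hherm : ∀ f : {k // k ≠ k₀} → {i // i ≠ i₀}, (embedSites f M).IsHermitian := fun f => by
    rw [Matrix.IsHermitian, conjTranspose_embedSites, hM.eq]
  have htwist : ∀ c ∈ 𝒞, twist W i₀ c X₁ = X₁ ∧ twist W i₀ c X₂ = X₂ := fun c hc => by
    constructor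
    · rw [hX₁, twist_embedSites W hf₁ (c' := c ∘ e₁) (congrArg c h₁) (fun _ => rfl),
        hMc _ (hC₁ c hc)]
    · rw [hX₂, twist_embedSites W hf₂ (c' := c ∘ e₂) (congrArg c h₂) (fun _ => rfl),
        hMc _ (hC₂ c hc)]
  have hcorr := card_mul_stateForm_embedSites_le (W.posSemidef 0) (W.trace_eq_one 0) hf₁ hf₂ hM
    (extrinsicSymmetry 𝒟 k₀) htrans hMs
    ((card_filter_mem_image_eq_ncard he₁ h₁ h₂ (fun _ => rfl) fun _ => rfl).trans ha)
    ((card_filter_mem_image_eq_ncard he₂ h₂ h₁ (fun _ => rfl) fun _ => rfl).trans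
      (by rw [Set.inter_comm, ha]))
  change (Fintype.card {k // k ≠ k₀} : ℝ) * (zeroForm W i₀ X₁ X₂ - zeroForm W k₀ 1 M ^ 2) ≤
    a * (p - zeroForm W k₀ 1 M ^ 2) at hcorr
  rw [← Nat.card_eq_fintype_card, hn, hp] at hcorr
  have hone : ∀ {f : {k // k ≠ k₀} → {i // i ≠ i₀}} (_ : f.Injective),
      zeroForm W i₀ 1 (embedSites f M) = p := fun hf => by
    rw [← embedSites_one (d := d) hf, ← hp, zeroForm_embedSites W hf]
  have hself : ∀ {f : {k // k ≠ k₀} → {i // i ≠ i₀}} (_ : f.Injective),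
      zeroForm W i₀ (embedSites f M) (embedSites f M) = p := fun hf =>
    zeroForm_embedSites W hf M M
  have hle := extrinsicMMSE_le_of_covariant W 𝒞 i₀ (M := (1 / 2 : ℝ) • (X₁ + X₂))
    (by rw [Matrix.IsHermitian, Matrix.conjTranspose_smul, star_trivial,
          ((hherm f₁).add (hherm f₂)).eq])
    (fun c hc => by rw [map_smul, map_add, (htwist c hc).1, (htwist c hc).2])
  refine hle.trans ?_
  rw [apply_sub_average_of_isPosSemidef hb (zeroForm_one_one W i₀) (hone hf₁) (hone hf₂)
    (hself hf₁) (hself hf₂)]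
  have hn' : (0 : ℝ) < n := by exact_mod_cast Nat.pos_of_ne_zero hn0
  have hcorr' : zeroForm W i₀ X₁ X₂ ≤ p ^ 2 + (a : ℝ) / n * (p - p ^ 2) := by
    rw [← sub_le_iff_le_add', div_mul_eq_mul_div, le_div_iff₀ hn', mul_comm]
    exact hcorr
  linarith

open Classical in
/-- The two-look bound for the extrinsic MMSE of a code with two projections into a code whose
symmetries fixing the decoded position are transitive on the other positions. -/
theorem extrinsicMMSE_le_of_two_looks {𝒞 : Submodule (ZMod 2) (ι → ZMod 2)}
    {𝒟 : Submodule (ZMod 2) (κ → ZMod 2)} {i₀ : ι} {k₀ : κ} {e₁ e₂ : κ → ι}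
    (he₁ : e₁.Injective) (he₂ : e₂.Injective) (h₁ : e₁ k₀ = i₀) (h₂ : e₂ k₀ = i₀)
    (hC₁ : ∀ c ∈ 𝒞, c ∘ e₁ ∈ 𝒟) (hC₂ : ∀ c ∈ 𝒞, c ∘ e₂ ∈ 𝒟)
    (htrans : ∀ i j : {k // k ≠ k₀}, ∃ g ∈ extrinsicSymmetry 𝒟 k₀, g i = j) {a n : ℕ}
    (ha : ((Set.range e₁ ∩ Set.range e₂) \ {i₀}).ncard = a) (hn : Nat.card {k // k ≠ k₀} = n)
    (hn0 : n ≠ 0) (han : a ≤ n) :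
    extrinsicMMSE W 𝒞 i₀ ≤ (1 + (a : ℝ) / n) / 2 * extrinsicMMSE W 𝒟 k₀ +
      (1 - (a : ℝ) / n) / 2 * extrinsicMMSE W 𝒟 k₀ ^ 2 := by
  have hκ0 : (0 : ℝ) ≤ (a : ℝ) / n := by positivity
  have hκ1 : (a : ℝ) / n ≤ 1 := div_le_one_of_le₀ (by exact_mod_cast han) (by positivity)
  set q : ℝ := (a : ℝ) / n with hq
  -- Truncating at `0`, the bound is a continuous monotone function of the error.
  let g : ℝ → ℝ := fun v => (1 + q) / 2 * max v 0 + (1 - q) / 2 * (max v 0) ^ 2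
  have hg : Monotone g := fun x y hxy => by
    have h : max x 0 ≤ max y 0 := max_le_max_right 0 hxy
    have h0 : 0 ≤ max x 0 := le_max_right _ _
    have : 0 ≤ (1 + q) / 2 := by linarith
    have : 0 ≤ (1 - q) / 2 := by linarith
    dsimp only [g]
    gcongr
  have hgc : Continuous g := by fun_prop
  have hnonneg : 0 ≤ extrinsicMMSE W 𝒟 k₀ := Real.iInf_nonneg fun M =>
    meanSquaredError_extrinsicState_nonneg W 𝒟 k₀ M.2
  have hle : extrinsicMMSE W 𝒞 i₀ ≤ g (extrinsicMMSE W 𝒟 k₀) := by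
    rw [extrinsicMMSE.eq_1 W 𝒟 k₀, minMeanSquaredError]
    have : Nonempty {M : Matrix ({k // k ≠ k₀} → Fin d) ({k // k ≠ k₀} → Fin d) ℂ //
      M.IsHermitian} := ⟨0, Matrix.isHermitian_zero⟩
    rw [hg.map_ciInf_of_continuousAt hgc.continuousAt (bddBelow_meanSquaredError W 𝒟 k₀)]
    refine le_ciInf fun M => ?_
    obtain ⟨M', hM', hc, hs, hp, hle⟩ := exists_symmetric_observable W 𝒟 k₀ M.2
    refine (extrinsicMMSE_le_of_symmetric_observable W he₁ he₂ h₁ h₂ hC₁ hC₂ htrans ha hn hn0 hM'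
      hc hs hp).trans ?_
    have hnn : 0 ≤ 1 - zeroForm W k₀ M' M' := by
      have hb := zeroForm_isPosSemidef W k₀
      have h := two_mul_apply_le_of_isPosSemidef hb 1 M'
      rw [hp, zeroForm_one_one] at h
      linarith
    refine le_trans (le_of_eq ?_) (hg hle)
    dsimp only [g]
    rw [max_eq_left hnn]
  simpa only [g, max_eq_left hnonneg] using hle

end TwoLooks

/-! ### Symmetries of Reed-Muller codes -/

section ReedMuller

open Classical in
theorem subtypePerm_mem_extrinsicSymmetry {ι : Type*} [Fintype ι]
    {𝒞 : Submodule (ZMod 2) (ι → ZMod 2)} {i₀ : ι} {π : Equiv.Perm ι} (h₀ : π i₀ = i₀)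
    (h : ∀ c : ι → ZMod 2, c ∘ π ∈ 𝒞 ↔ c ∈ 𝒞) (hne : ∀ i, π i ≠ i₀ ↔ i ≠ i₀) :
    π.subtypePerm hne ∈ extrinsicSymmetry 𝒞 i₀ := fun c => by
  rw [Equiv.Perm.ofSubtype_subtypePerm (p := fun i => i ≠ i₀) hne
    fun i hi h' => hi (by rw [h', h₀]), h]

variable {m : ℕ}

theorem totalDegree_bind₁_le_of_totalDegree_le_one {σ τ R : Type*} [CommSemiring R]
    {q : σ → MvPolynomial τ R} (hq : ∀ i, (q i).totalDegree ≤ 1) (p : MvPolynomial σ R) :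
    (MvPolynomial.bind₁ q p).totalDegree ≤ p.totalDegree := by
  rw [p.as_sum, map_sum, ← p.as_sum]
  refine MvPolynomial.totalDegree_finsetSum_le fun s hs => ?_
  rw [MvPolynomial.bind₁_monomial]
  refine (MvPolynomial.totalDegree_mul _ _).trans ?_
  rw [MvPolynomial.totalDegree_C, zero_add]
  refine (MvPolynomial.totalDegree_finsetProd _ _).trans ?_
  refine le_trans (Finset.sum_le_sum fun i _ => ?_) (MvPolynomial.le_totalDegree hs)
  exact (MvPolynomial.totalDegree_pow _ _).trans 
    ((Nat.mul_le_mul_left _ (hq i)).trans_eq (mul_one _))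

theorem binaryPoint_injective (m : ℕ) : (binaryPoint m).Injective := by
  intro x y h
  refine Fin.ext (Nat.eq_of_testBit_eq fun i => ?_)
  by_cases hi : i < m
  · have h' := congrFun h ⟨i, hi⟩
    simp only [binaryPoint] at h'
    cases hx : (x : ℕ).testBit i <;> cases hy : (y : ℕ).testBit i <;> simp_all
  · have hle : ∀ z : Fin (2 ^ m), (z : ℕ).testBit i = false := fun z =>
      Nat.testBit_lt_two_pow (z.2.trans_le (Nat.pow_le_pow_right two_pos (not_lt.mp hi)))
    rw [hle, hle]

theorem binaryPoint_zero (m : ℕ) : binaryPoint m 0 = 0 := by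
  funext i
  simp [binaryPoint]

/-- The numbering of the points of `𝔽₂ᵐ` by their binary expansions. -/
def binaryPointEquiv (m : ℕ) : Fin (2 ^ m) ≃ (Fin m → ZMod 2) :=
  Equiv.ofBijective (binaryPoint m)
    ((Fintype.bijective_iff_injective_and_card _).mpr ⟨binaryPoint_injective m, by simp⟩)

/-- Reed-Muller codes are invariant under linear changes of coordinates. -/
theorem comp_mem_reedMuller {r : ℕ} {c : Fin (2 ^ m) → ZMod 2} (hc : c ∈ reedMuller r m)
    (A : (Fin m → ZMod 2) →ₗ[ZMod 2] (Fin m → ZMod 2)) {π : Fin (2 ^ m) → Fin (2 ^ m)}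
    (hπ : ∀ ℓ, binaryPoint m (π ℓ) = A (binaryPoint m ℓ)) : c ∘ π ∈ reedMuller r m := by
  obtain ⟨p, hp, rfl⟩ := hc
  let q : Fin m → MvPolynomial (Fin m) (ZMod 2) := fun i =>
    ∑ j, MvPolynomial.C (A (fun k => if j = k then 1 else 0) i) * MvPolynomial.X j
  have hq : ∀ i, (q i).totalDegree ≤ 1 := fun i =>
    MvPolynomial.totalDegree_finsetSum_le fun j _ =>
      (MvPolynomial.totalDegree_mul _ _).trans (by
        rw [MvPolynomial.totalDegree_C, zero_add, MvPolynomial.totalDegree_X])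
  have hp' := (MvPolynomial.mem_restrictTotalDegree _ _ _).mp hp
  refine ⟨MvPolynomial.bind₁ q p, (MvPolynomial.mem_restrictTotalDegree _ _ _).mpr
    ((totalDegree_bind₁_le_of_totalDegree_le_one hq p).trans hp'), ?_⟩
  funext ℓ
  simp only [evalAllPoints, LinearMap.pi_apply, AlgHom.toLinearMap_apply, Function.comp_apply,
    MvPolynomial.aeval_bind₁, hπ]
  congr 2
  funext i
  rw [LinearMap.pi_apply_eq_sum_univ A, Finset.sum_apply]
  simp only [q, map_sum, map_mul, MvPolynomial.aeval_C, MvPolynomial.aeval_X]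
  exact Finset.sum_congr rfl fun j _ => mul_comm _ _

/-- A nonzero vector of `𝔽₂ᵐ` is carried to any other one by a linear involution (a
transvection). -/
theorem exists_linear_involution {u v : Fin m → ZMod 2} (hu : u ≠ 0) (hv : v ≠ 0) :
    ∃ A : (Fin m → ZMod 2) →ₗ[ZMod 2] (Fin m → ZMod 2), (∀ x, A (A x) = x) ∧ A u = v := by
  -- A linear form taking the value `1` at both vectors.
  obtain ⟨f, hfu, hfv⟩ : ∃ f : (Fin m → ZMod 2) →ₗ[ZMod 2] ZMod 2, f u = 1 ∧ f v = 1 := by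
    have hone : ∀ {w : Fin m → ZMod 2} {i}, w i ≠ 0 → w i = 1 := fun {w i} h =>
      (zmod_two_eq_zero_or_one (w i)).resolve_left h
    obtain ⟨i, hi⟩ := Function.ne_iff.mp hu
    obtain ⟨j, hj⟩ := Function.ne_iff.mp hv
    by_cases hvi : v i = 0
    · by_cases huj : u j = 0
      · refine ⟨(LinearMap.proj i : (Fin m → ZMod 2) →ₗ[ZMod 2] ZMod 2) + LinearMap.proj j,
          ?_, ?_⟩
        · rw [LinearMap.add_apply, LinearMap.proj_apply, LinearMap.proj_apply, hone hi, huj,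
            add_zero]
        · rw [LinearMap.add_apply, LinearMap.proj_apply, LinearMap.proj_apply, hone hj, hvi,
            zero_add]
      · exact ⟨LinearMap.proj j, hone huj, hone hj⟩
    · exact ⟨LinearMap.proj i, hone hi, hone hvi⟩
  refine ⟨LinearMap.id + f.smulRight (u + v), fun x => ?_, ?_⟩
  · have huv : f (u + v) = 0 := by rw [map_add, hfu, hfv, CharTwo.add_self_eq_zero]
    change x + f x • (u + v) + f (x + f x • (u + v)) • (u + v) = x
    rw [map_add f x, map_smul, huv, smul_zero, add_zero, add_assoc, ← add_smul,
      CharTwo.add_self_eq_zero, zero_smul, add_zero]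
  · change u + f u • (u + v) = v
    have huu : u + u = 0 := funext fun k => CharTwo.add_self_eq_zero (u k)
    rw [hfu, one_smul, ← add_assoc, huu, zero_add]

/-- The symmetries of a Reed-Muller code fixing the position `0` are transitive on the others. -/
theorem exists_mem_extrinsicSymmetry_reedMuller (r m : ℕ) (i j : {ℓ : Fin (2 ^ m) // ℓ ≠ 0}) :
    ∃ g ∈ extrinsicSymmetry (reedMuller r m) 0, g i = j := by
  classical
  have hne : ∀ ℓ : {ℓ : Fin (2 ^ m) // ℓ ≠ 0}, binaryPoint m ℓ ≠ 0 := fun ℓ h =>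
    ℓ.2 (binaryPoint_injective m (h.trans (binaryPoint_zero m).symm))
  obtain ⟨A, hAA, hA⟩ := exists_linear_involution (hne i) (hne j)
  let E := binaryPointEquiv m
  have hEE : ∀ ℓ, E.symm (A (E (E.symm (A (E ℓ))))) = ℓ := fun ℓ => by
    rw [Equiv.apply_symm_apply, hAA, Equiv.symm_apply_apply]
  let π : Equiv.Perm (Fin (2 ^ m)) :=
    ⟨fun ℓ => E.symm (A (E ℓ)), fun ℓ => E.symm (A (E ℓ)), hEE, hEE⟩
  have hπ : ∀ ℓ, binaryPoint m (π ℓ) = A (binaryPoint m ℓ) := fun ℓ => E.apply_symm_apply _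
  have hππ : (π : Fin (2 ^ m) → Fin (2 ^ m)) ∘ π = id := funext hEE
  have hπ0 : π 0 = 0 := binaryPoint_injective m (by rw [hπ, binaryPoint_zero, map_zero])
  have hπne : ∀ ℓ, π ℓ ≠ 0 ↔ ℓ ≠ 0 := fun ℓ => by
    rw [← hπ0, π.injective.ne_iff, hπ0]
  refine ⟨π.subtypePerm hπne, ?_, Subtype.ext (binaryPoint_injective m ?_)⟩
  · refine subtypePerm_mem_extrinsicSymmetry hπ0 (fun c => ?_) hπne
    refine ⟨fun h => ?_, fun h => comp_mem_reedMuller h A hπ⟩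
    have h' := comp_mem_reedMuller h A hπ
    rwa [Function.comp_assoc, hππ, Function.comp_id] at h'
  · rw [Equiv.Perm.subtypePerm_apply, hπ, hA]

end ReedMuller

end

theorem mainTheorem3 {d : ℕ} (W : BSCQChannel d) (r m : ℕ) (hm : 2 ≤ m)
    (A B C : Finset (Fin (2 ^ m)))
    (hA : 0 ∉ A) (hB : 0 ∉ B) (hC : 0 ∉ C)
    (hdAB : Disjoint A B) (hdAC : Disjoint A C) (hdBC : Disjoint B C)
    (hcardAB : (insert 0 (A ∪ B)).card = 2 ^ (m - 1))
    (hcardAC : (insert 0 (A ∪ C)).card = 2 ^ (m - 1))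
    (hprojAB : codeProjection (reedMuller r m) (insert 0 (A ∪ B)) hcardAB = reedMuller r (m - 1))
    (hprojAC : codeProjection (reedMuller r m) (insert 0 (A ∪ C)) hcardAC = reedMuller r (m - 1))
    (κ : ℝ) (hκ : κ = (A.card : ℝ) / ((A.card : ℝ) + (B.card : ℝ))) :
    extrinsicMMSE W (reedMuller r m) 0 ≤
      (1 + κ) / 2 *
          extrinsicMMSE W (codeProjection (reedMuller r m) (insert 0 (A ∪ B)) hcardAB) 0 +
        (1 - κ) / 2 *
          extrinsicMMSE W (codeProjection (reedMuller r m) (insert 0 (A ∪ B)) hcardAB) 0 ^ 2 := by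
  have hzero : ∀ {S : Finset (Fin (2 ^ m))} (h : (insert 0 S).card = 2 ^ (m - 1)),
      (insert 0 S).orderEmbOfFin h 0 = 0 := fun {S} h => by
    have h0 := Finset.orderEmbOfFin_zero h (by positivity)
    refine (Eq.trans ?_ h0).trans ?_
    · congr 1
    · exact le_antisymm (Finset.min'_le _ _ (Finset.mem_insert_self 0 S)) (Fin.zero_le _)
  have hn : Nat.card {k : Fin (2 ^ (m - 1)) // k ≠ 0} = A.card + B.card := by
    rw [Finset.card_insert_of_notMem (by simp [hA, hB]), Finset.card_union_of_disjoint hdAB]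
      at hcardAB
    rw [Nat.card_eq_fintype_card, Fintype.card_subtype_compl, Fintype.card_fin,
      Fintype.card_subtype_eq, ← hcardAB, Nat.add_sub_cancel]
  have hpos : A.card + B.card ≠ 0 := fun h => by
    rw [Finset.card_insert_of_notMem (by simp [hA, hB]), Finset.card_union_of_disjoint hdAB, h]
      at hcardAB
    have : 2 ^ 1 ≤ 2 ^ (m - 1) := Nat.pow_le_pow_right two_pos (by omega)
    omega
  have ha : ((Set.range ((insert 0 (A ∪ B)).orderEmbOfFin hcardAB) ∩
      Set.range ((insert 0 (A ∪ C)).orderEmbOfFin hcardAC)) \ {0}).ncard = A.card := by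
    rw [Finset.range_orderEmbOfFin, Finset.range_orderEmbOfFin, ← Set.ncard_coe_finset]
    congr 1
    ext i
    have hBC : i ∈ B → i ∉ C := fun h => Finset.disjoint_left.mp hdBC h
    have hA0 : i ∈ A → i ≠ 0 := fun h h0 => hA (h0 ▸ h)
    simp only [Finset.coe_insert, Finset.coe_union, Set.mem_sdiff, Set.mem_inter_iff,
      Set.mem_insert_iff, Set.mem_union, Finset.mem_coe, Set.mem_singleton_iff]
    tauto
  have hmem : ∀ {I : Finset (Fin (2 ^ m))} (h : I.card = 2 ^ (m - 1)),
      codeProjection (reedMuller r m) I h = reedMuller r (m - 1) →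
      ∀ c ∈ reedMuller r m, c ∘ I.orderEmbOfFin h ∈ reedMuller r (m - 1) := fun h hI c hc =>
    hI ▸ Submodule.mem_map_of_mem hc
  rw [hprojAB, hκ, ← Nat.cast_add]
  exact extrinsicMMSE_le_of_two_looks W (Finset.orderEmbOfFin _ hcardAB).injective
    (Finset.orderEmbOfFin _ hcardAC).injective (hzero hcardAB) (hzero hcardAC)
    (hmem hcardAB hprojAB) (hmem hcardAC hprojAC)
    (exists_mem_extrinsicSymmetry_reedMuller r (m - 1)) ha hn hpos (Nat.le_add_right _ _)
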